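/- Consider the continuous stirred tank reactor model $$\dot C_A=\theta_1-\theta_2C_A-k_0e^{-\theta_5/T}C_A,\qquad \dot T=\theta_2(T_{in}-T)-\theta_3k_0e^{-\theta_5/T}C_A+\theta_4u,$$ with known $k_0>0$, measured signals $C_A,T,T_{in},u$ and unknown $\theta\in\mathbb R^5$, where $\theta_1,\theta_2,\theta_4,\theta_5>0$ and $\theta_3\neq0$ has known sign (for instance $\theta\in\mathbb R^5_+$). Choose tuning constants, independent of $\theta$ except for the sign of $\gamma_b$: $\lambda,\alpha,\beta_0,f_0,\gamma_a>0$, $M\ge 1/f_0$, $\mu^0\in\mathbb R^5$ and $\gamma_b$ with $\gamma_b\theta_3>0$. For a signal $v$ let $\frac{\lambda}{p+\lambda}(v)$ be the zero-state response of the filter, and let $\frac{\lambda p}{p+\lambda}(v)=\frac{\lambda}{p+\lambda}(\dot v)$. Put $y=\frac{\lambda p}{p+\lambda}(-T)$ and $$\varphi=\mathrm{col}\Big(1-e^{-\lambda t},\ \tfrac{\lambda}{p+\lambda}(T-T_{in}),\ \tfrac{\lambda p}{p+\lambda}(-C_A),\ \tfrac{\lambda}{p+\lambda}(-u),\ \tfrac{\lambda}{p+\lambda}(-C_A)\Big).$$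 These signals are generated by six first-order filters driven by $1,\ T-T_{in},\ C_A,\ u,\ C_A,\ T$, started at $0,0,C_A(0),0,0,T(0)$, so that $y(0)=0$ and $\varphi(0)=0$. Consider the estimator consisting of these filters and $$\dot{\hat\mu}=\alpha F\varphi(y-\varphi^\top\hat\mu),\qquad \dot F=-\alpha F\varphi\varphi^\top F+\beta F,\qquad \dot z=-\beta z,\qquad \dot{\hat\eta}_i=\gamma_a\Delta(\mathcal Y_i-\Delta\hat\eta_i)\ \ (i=1,\dots,4),$$ $$\dot\rho_I=-\frac{\gamma_b}{T}\Big(\hat\theta_2(T_{in}-T)+\hat\theta_4u-\hat\theta_3k_0C_Ae^{-\hat\theta_5/T}\Big),$$ where $\beta=\beta_0(1-\|F\|/M)$ with $\|\cdot\|$ the spectral norm, $\Delta=\det(I_5-zf_0F)$, $\mathcal Y=\mathrm{adj}(I_5-zf_0F)\,(\hat\mu-zf_0F\mu^0)$, with outputs $\hat\theta_1=\hat\eta_1/\hat\eta_3$, $\hat\theta_i=\hat\eta_i$ for $i=2,3,4$, and $\hat\theta_5=\gamma_b\ln T+\rho_I$. It has the form $\dot\chi=F_\chi(\chi,C_A,T,T_{in},u)$,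 $\hat\theta=H_\chi(\chi,C_A,T,T_{in},u)$ with $\chi(t)\in\mathbb R^{42}$. It is initialized with $\hat\mu(0)=\mu^0$, $F(0)=\frac1{f_0}I_5$, $z(0)=1$, and arbitrary initial estimates $\rho_I(0)\in\mathbb R$ and $\hat\eta(0)\in\mathbb R^4$ with $\hat\eta_3(0)\theta_3>0$ (for instance $\hat\eta(0)\in\mathbb R^4_+$ if $\theta_3>0$). Let $C_A(0),T(0)>0$, let $T_{in}$ be bounded and right-continuous, and let $u$ be any continuous input, not necessarily bounded, that generates on $[0,\infty)$ a state trajectory contained in a compact subset of $\mathbb R_+^2$ (that is, $C_A$ and $T$ are bounded and $\inf_{t\ge0}T(t)>0$; $C_A$ then automatically stays away from $0$). Assume that $\varphi$ is interval exciting: there are $c_c,t_c>0$ with $\int_0^{t_c}\varphi(s)\varphi(s)^\top ds\ge c_cI_5$. Then the estimator has a solution on $[0,\infty)$, and every such solution satisfies: $\hat\eta_3(t)\ne0$ for all $t\ge0$; there are $c$ and $\kappa>0$ with $|\hat\theta(t)-\theta|\le ce^{-\kappa t}$ for all $t\ge0$; and $\chi$ and $\hat\theta$ are bounded on $[0,\infty)$.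 (Where $T_{in}$ jumps, derivatives are right derivatives.) -/

import Mathlib

open Set MeasureTheory

namespace CSTR

noncomputable section

/-! Conventions. Time is `t ≥ 0`.  Vectors `a₁, …, aₙ` are indexed from `0` in `Fin n`, so
`θ 0, …, θ 4` are the parameters `θ₁, …, θ₅`. -/

/-- `x` solves the ordinary differential equation `ẋ = v` on `[0, ∞)`: it is continuous there and
its right derivative at every `t ≥ 0` is `v t`.  If `v` is continuous these are the classical
solutions; right derivatives also cover measured signals with step changes. -/
def SolvesODE {E : Type*} [NormedAddCommGroup E] [NormedSpace ℝ E]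
    (x : ℝ → E) (v : ℝ → E) : Prop :=
  ContinuousOn x (Ici 0) ∧ ∀ t : ℝ, 0 ≤ t → HasDerivWithinAt x (v t) (Ici t) t

/-- The reactor model with concentration `CA`, temperature `T`, influent temperature `Tin`
and input `u`. -/
def IsReactorTrajectory (k₀ : ℝ) (θ : Fin 5 → ℝ) (CA T Tin u : ℝ → ℝ) : Prop :=
  SolvesODE CA (fun t => θ 0 - θ 1 * CA t - k₀ * Real.exp (-(θ 4 / T t)) * CA t) ∧
  SolvesODE T (fun t => θ 1 * (Tin t - T t) - θ 2 * k₀ * Real.exp (-(θ 4 / T t)) * CA t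
    + θ 3 * u t)

/-- A trajectory that is bounded in the state space `ℝ₊ × ℝ₊`: both states are bounded, and the
absolute temperature stays away from the boundary point `0` of the state space. -/
def BoundedTrajectory (CA T : ℝ → ℝ) : Prop :=
  ∃ a b : ℝ, 0 < a ∧ ∀ t : ℝ, 0 ≤ t → |CA t| ≤ b ∧ a ≤ T t ∧ T t ≤ b

/-- The influent temperature: bounded, measurable, continuous from the right. -/
def AdmissibleInfluent (Tin : ℝ → ℝ) : Prop :=
  Measurable Tin ∧ (∃ b : ℝ, ∀ t : ℝ, 0 ≤ t → |Tin t| ≤ b) ∧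
    ∀ t : ℝ, 0 ≤ t → ContinuousWithinAt Tin (Ici t) t

/-- Zero-state response of the filter `λ / (p + λ)` to the signal `v`. -/
def lowpass (lam : ℝ) (v : ℝ → ℝ) (t : ℝ) : ℝ :=
  ∫ s in (0 : ℝ)..t, lam * Real.exp (-(lam * (t - s))) * v s

/-- The action of `λ p / (p + λ)` on `v`, that is, the zero-state response of `λ / (p + λ)` to
the derivative of `v`, with the derivative removed by an integration by parts. -/
def dirty (lam : ℝ) (v : ℝ → ℝ) (t : ℝ) : ℝ :=
  lam * (v t - Real.exp (-(lam * t)) * v 0 - lowpass lam v t)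

/-- The regressor `φ`.  Its first entry, the filtered constant `1`, equals `1 - exp (-λ t)`. -/
def regressor (lam : ℝ) (CA T Tin u : ℝ → ℝ) (t : ℝ) : Fin 5 → ℝ :=
  ![lowpass lam (fun _ => 1) t,
    lowpass lam (fun s => T s - Tin s) t,
    dirty lam (fun s => -CA s) t,
    lowpass lam (fun s => -u s) t,
    lowpass lam (fun s => -CA s) t]

/-- Interval excitation: `∫₀^{t_c} φ(s) φ(s)ᵀ ds ≥ c_c I` for some `c_c, t_c > 0`. -/
def IntervalExciting (φ : ℝ → Fin 5 → ℝ) : Prop :=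
  ∃ c tc : ℝ, 0 < c ∧ 0 < tc ∧
    (Matrix.of (fun i j : Fin 5 => ∫ s in (0 : ℝ)..tc, φ s i * φ s j)
      - c • (1 : Matrix (Fin 5) (Fin 5) ℝ)).PosSemidef

/-- The tuning constants of the estimator. -/
structure Gains where
  lam : ℝ
  α : ℝ
  β₀ : ℝ
  f₀ : ℝ
  M : ℝ
  γa : ℝ
  γb : ℝ
  μ₀ : Fin 5 → ℝ

/-- Restrictions on the tuning constants that do not involve the plant. -/
def Gains.Admissible (g : Gains) : Prop :=
  0 < g.lam ∧ 0 < g.α ∧ 0 < g.β₀ ∧ 0 < g.f₀ ∧ 1 / g.f₀ ≤ g.M ∧ 0 < g.γa ∧ g.γb ≠ 0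

/-- Index set of the estimator state `χ ∈ ℝ⁴²`: six filter states, `μ̂`, the matrix `F`, `η̂₁ … η̂₄`,
`z` and `ρ_I`. -/
abbrev ChiIdx : Type :=
  Fin 6 ⊕ Fin 5 ⊕ (Fin 5 × Fin 5) ⊕ Fin 4 ⊕ Fin 1 ⊕ Fin 1

/-- The estimator state space. -/
abbrev Chi : Type := ChiIdx → ℝ

/-- Assembling an estimator state from its blocks. -/
def Chi.mk (x : Fin 6 → ℝ) (μ : Fin 5 → ℝ) (F : Matrix (Fin 5) (Fin 5) ℝ) (η : Fin 4 → ℝ)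
    (z ρ : ℝ) : Chi :=
  Sum.elim x (Sum.elim μ (Sum.elim (fun p => F p.1 p.2)
    (Sum.elim η (Sum.elim (fun _ => z) (fun _ => ρ)))))

/-- Filter states, in this order: filtered `1`, `T - Tin`, `CA` (started at `CA(0)`), `u`,
`CA` (started at `0`), `T` (started at `T(0)`). -/
def filt (χ : Chi) (i : Fin 6) : ℝ := χ (.inl i)

/-- The least-squares estimate `μ̂`. -/
def muHat (χ : Chi) (i : Fin 5) : ℝ := χ (.inr (.inl i))

/-- The least-squares gain matrix `F`. -/
def Fmat (χ : Chi) : Matrix (Fin 5) (Fin 5) ℝ :=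
  Matrix.of fun i j => χ (.inr (.inr (.inl (i, j))))

/-- The estimates `η̂₁, …, η̂₄`. -/
def etaHat (χ : Chi) (i : Fin 4) : ℝ := χ (.inr (.inr (.inr (.inl i))))

/-- The state `z`. -/
def zState (χ : Chi) : ℝ := χ (.inr (.inr (.inr (.inr (.inl 0)))))

/-- The integral term `ρ_I`. -/
def rhoI (χ : Chi) : ℝ := χ (.inr (.inr (.inr (.inr (.inr 0)))))

/-- The signal `y = (λ p / (p + λ))(-T)` computed from the filter states. -/
def ySig (g : Gains) (χ : Chi) (T : ℝ) : ℝ := -(g.lam * (T - filt χ 5))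

/-- The regressor `φ` computed from the filter states. -/
def phiSig (g : Gains) (χ : Chi) (CA : ℝ) : Fin 5 → ℝ :=
  ![filt χ 0, filt χ 1, -(g.lam * (CA - filt χ 2)), -filt χ 3, -filt χ 4]

/-- Forgetting factor `β = β₀ (1 - ‖F‖ / M)`, with the spectral (Euclidean operator) norm. -/
def beta (g : Gains) (χ : Chi) : ℝ :=
  g.β₀ * (1 - ‖Matrix.toEuclideanCLM (n := Fin 5) (𝕜 := ℝ) (Fmat χ)‖ / g.M)

/-- The matrix `I - z f₀ F`. -/
def mixMat (g : Gains) (χ : Chi) : Matrix (Fin 5) (Fin 5) ℝ :=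
  1 - (zState χ * g.f₀) • Fmat χ

/-- The scalar regressor `Δ = det (I - z f₀ F)`. -/
def Delta (g : Gains) (χ : Chi) : ℝ := (mixMat g χ).det

/-- The vector `𝒴 = adj (I - z f₀ F) (μ̂ - z f₀ F μ⁰)`. -/
def Yvec (g : Gains) (χ : Chi) : Fin 5 → ℝ :=
  Matrix.mulVec (mixMat g χ).adjugate
    (muHat χ - (zState χ * g.f₀) • Matrix.mulVec (Fmat χ) g.μ₀)

/-- The output map: `θ̂₁ = η̂₁ / η̂₃`, `θ̂ᵢ = η̂ᵢ` for `i = 2, 3, 4`, `θ̂₅ = γ_b ln T + ρ_I`. -/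
def outputMap (g : Gains) (χ : Chi) (_CA T _Tin _u : ℝ) : Fin 5 → ℝ :=
  ![etaHat χ 0 / etaHat χ 2, etaHat χ 1, etaHat χ 2, etaHat χ 3,
    g.γb * Real.log T + rhoI χ]

/-- The right-hand side `F_χ(χ, CA, T, Tin, u)` of the estimator. -/
def vectorField (k₀ : ℝ) (g : Gains) (χ : Chi) (CA T Tin u : ℝ) : Chi :=
  let φ := phiSig g χ CA
  let F := Fmat χ
  let θh := outputMap g χ CA T Tin u
  Chi.mk
    (fun i => g.lam * ((![1, T - Tin, CA, u, CA, T] : Fin 6 → ℝ) i - filt χ i))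
    ((g.α * (ySig g χ T - φ ⬝ᵥ muHat χ)) • Matrix.mulVec F φ)
    (-(g.α • (F * Matrix.vecMulVec φ φ * F)) + beta g χ • F)
    (fun i => g.γa * Delta g χ * (Yvec g χ i.castSucc - Delta g χ * etaHat χ i))
    (-(beta g χ * zState χ))
    (g.γb * (θh 1 * (Tin - T) + θh 3 * u - θh 2 * k₀ * CA * Real.exp (-(θh 4 / T)))
      * (-(1 / T)))

/-- The initial state of the estimator with initial estimates `eta0` and initial integral term
`rho0`, for the measured values `CA(0)` and `T(0)`: the filters start with `y(0) = 0`, `φ(0) = 0`,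
and `μ̂(0) = μ⁰`, `F(0) = I / f₀`, `z(0) = 1`. -/
def initialState (g : Gains) (eta0 : Fin 4 → ℝ) (rho0 CA0 T0 : ℝ) : Chi :=
  Chi.mk ![0, 0, CA0, 0, 0, T0] g.μ₀ ((1 / g.f₀) • (1 : Matrix (Fin 5) (Fin 5) ℝ)) eta0 1 rho0

/-- `χ` is a run of the estimator on the measured signals, from the state `χ0`. -/
def IsEstimatorRun (k₀ : ℝ) (g : Gains) (CA T Tin u : ℝ → ℝ) (χ0 : Chi) (χ : ℝ → Chi) : Prop :=
  χ 0 = χ0 ∧ SolvesODE χ (fun t => vectorField k₀ g (χ t) (CA t) (T t) (Tin t) (u t))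

end

end CSTR

/-!
The plant is linear in the unknown `μ = (θ₁θ₃, θ₂, θ₃, θ₄, θ₂θ₃)` once the reaction rate is
eliminated between its two equations; filtering gives the exact regression `y = φ ⬝ᵥ μ`
(`filtered_regression`), since the defect solves `ḋ = -λ d` from `d(0) = 0`.

*Least squares.* The matrix `Q = f₀ I + ∫ (α / z) φ φᵀ` is the inverse of `z F`
(`LeastSquares.mul_info`), so that `μ̂ - μ = f₀ z F (μ⁰ - μ)` and mixing with the adjugate of
`I - z f₀ F` yields the scalar regressions `𝒴ᵢ = Δ μᵢ` (`LeastSquares.mixing`). The forgetting factor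
keeps `‖F‖ ≤ M`, hence `z ≤ 1`, and after the interval of excitation `Q ≥ f₀ + α c`, which bounds
`Δ = det (I - f₀ Q⁻¹)` from below for all later times (`LeastSquares.det_mix_bounds`). Therefore all
errors `η̂ᵢ - μᵢ` are multiples of one exponentially decreasing factor `E ∈ (0, 1]`
(`Run.exists_error_factor`); in particular `η̂₃` stays between its initial value and `θ₃`.

*The exponent.* The error of `θ̂₅` obeys a scalar equation that is monotone in `θ̂₅`, with a
perturbation containing `E u`, where `u` need not be bounded. As `θ₄ u = Ṫ + O(1)`, a multiple of
`E log T` added to the error removes this term. What is left is `ẋ = G (p exp (-(x - s) / T) - q) + r`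
with `p → q`, `s → 0`, `r → 0` exponentially, and `expDecay_of_exponential_feedback` applies.

*Existence.* The estimator is a cascade. With `y = z exp (β₀ t)` the pair `(y, Q)` solves an
equation whose right-hand side agrees, on the region `y ≥ 1`, `Q ≥ f₀` where its solutions stay, with
a bounded and Lipschitz one (`exists_information`); the same is true of the integral term `ρ_I`
after the terms with the measured signals have been integrated (`exists_exponential_ode`). Solutions
of such equations are global by Picard–Lindelöf (`exists_solvesODE`); all other states are explicit.

Most estimates on solutions rest on one fact about right derivatives: a function that starts below a
level and has nonpositive derivative whenever it is above stays below (`SolvesODE.le_of_nonpos`).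
-/

namespace CSTR

noncomputable section

/-! ### Calculus of right derivatives -/

section ODE

variable {E : Type*} [NormedAddCommGroup E] [NormedSpace ℝ E]

namespace SolvesODE

theorem congr {x v w : ℝ → E} (h : SolvesODE x v) (hvw : ∀ t, 0 ≤ t → v t = w t) :
    SolvesODE x w :=
  ⟨h.1, fun t ht => hvw t ht ▸ h.2 t ht⟩

theorem congr_left {x y v : ℝ → E} (h : SolvesODE x v) (hxy : ∀ t, 0 ≤ t → x t = y t) :
    SolvesODE y v :=
  ⟨h.1.congr fun t ht => (hxy t ht).symm, fun t ht =>
    (h.2 t ht).congr (fun s hs => (hxy s (ht.trans hs)).symm) (hxy t ht).symm⟩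

theorem const (c : E) : SolvesODE (fun _ => c) (fun _ => 0) :=
  ⟨continuousOn_const, fun t _ => hasDerivWithinAt_const t _ c⟩

theorem of_hasDerivAt {x v : ℝ → E} (h : ∀ t, HasDerivAt x (v t) t) : SolvesODE x v :=
  ⟨fun t _ => (h t).continuousAt.continuousWithinAt, fun t _ => (h t).hasDerivWithinAt⟩

theorem add {x y v w : ℝ → E} (hx : SolvesODE x v) (hy : SolvesODE y w) :
    SolvesODE (fun t => x t + y t) (fun t => v t + w t) :=
  ⟨hx.1.add hy.1, fun t ht => (hx.2 t ht).add (hy.2 t ht)⟩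

theorem sub {x y v w : ℝ → E} (hx : SolvesODE x v) (hy : SolvesODE y w) :
    SolvesODE (fun t => x t - y t) (fun t => v t - w t) :=
  ⟨hx.1.sub hy.1, fun t ht => (hx.2 t ht).sub (hy.2 t ht)⟩

theorem neg {x v : ℝ → E} (hx : SolvesODE x v) : SolvesODE (fun t => -x t) (fun t => -v t) :=
  ⟨hx.1.neg, fun t ht => (hx.2 t ht).neg⟩

theorem const_smul (c : ℝ) {x v : ℝ → E} (hx : SolvesODE x v) :
    SolvesODE (fun t => c • x t) (fun t => c • v t) :=
  ⟨hx.1.const_smul c, fun t ht => (hx.2 t ht).const_smul c⟩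

theorem smul {a a' : ℝ → ℝ} {x v : ℝ → E} (ha : SolvesODE a a') (hx : SolvesODE x v) :
    SolvesODE (fun t => a t • x t) (fun t => a t • v t + a' t • x t) :=
  ⟨ha.1.smul hx.1, fun t ht => (ha.2 t ht).smul (hx.2 t ht)⟩

theorem mul {R : Type*} [NormedRing R] [NormedAlgebra ℝ R] {x y v w : ℝ → R}
    (hx : SolvesODE x v) (hy : SolvesODE y w) :
    SolvesODE (fun t => x t * y t) (fun t => v t * y t + x t * w t) :=
  ⟨hx.1.mul hy.1, fun t ht => (hx.2 t ht).mul (hy.2 t ht)⟩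

theorem const_mul {x v : ℝ → ℝ} (c : ℝ) (hx : SolvesODE x v) :
    SolvesODE (fun t => c * x t) (fun t => c * v t) :=
  hx.const_smul c

theorem sum {ι : Type*} (s : Finset ι) {x v : ι → ℝ → E} (h : ∀ i ∈ s, SolvesODE (x i) (v i)) :
    SolvesODE (fun t => ∑ i ∈ s, x i t) (fun t => ∑ i ∈ s, v i t) :=
  ⟨continuousOn_finsetSum s fun i hi => (h i hi).1, fun t ht =>
    HasDerivWithinAt.fun_sum fun i hi => (h i hi).2 t ht⟩

theorem clm {G : Type*} [NormedAddCommGroup G] [NormedSpace ℝ G] (L : E →L[ℝ] G) {x v : ℝ → E}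
    (hx : SolvesODE x v) : SolvesODE (fun t => L (x t)) (fun t => L (v t)) :=
  ⟨L.continuous.comp_continuousOn hx.1, fun t ht =>
    L.hasFDerivAt.comp_hasDerivWithinAt t (hx.2 t ht)⟩

theorem comp {x v : ℝ → ℝ} {f : ℝ → E} {f' : ℝ → E} (hx : SolvesODE x v)
    (hf : ∀ t, 0 ≤ t → HasDerivAt f (f' t) (x t)) :
    SolvesODE (fun t => f (x t)) (fun t => v t • f' t) :=
  ⟨fun t ht => ((hf t ht).continuousAt.comp_continuousWithinAt (hx.1 t ht)), fun t ht =>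
    (hf t ht).scomp_hasDerivWithinAt t (hx.2 t ht)⟩

theorem exp {x v : ℝ → ℝ} (hx : SolvesODE x v) :
    SolvesODE (fun t => Real.exp (x t)) (fun t => v t * Real.exp (x t)) :=
  hx.comp fun t _ => Real.hasDerivAt_exp (x t)

theorem log {x v : ℝ → ℝ} (hx : SolvesODE x v) (h0 : ∀ t, 0 ≤ t → x t ≠ 0) :
    SolvesODE (fun t => Real.log (x t)) (fun t => v t * (x t)⁻¹) :=
  hx.comp fun t ht => Real.hasDerivAt_log (h0 t ht)

theorem inv {x v : ℝ → ℝ} (hx : SolvesODE x v) (h0 : ∀ t, 0 ≤ t → x t ≠ 0) :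
    SolvesODE (fun t => (x t)⁻¹) (fun t => v t * -(x t ^ 2)⁻¹) :=
  hx.comp fun t ht => hasDerivAt_inv (h0 t ht)

theorem pi {ι : Type*} [Fintype ι] {x v : ℝ → ι → ℝ}
    (h : ∀ i, SolvesODE (fun t => x t i) (fun t => v t i)) : SolvesODE x v :=
  ⟨continuousOn_pi.2 fun i => (h i).1, fun t ht => hasDerivWithinAt_pi.2 fun i => (h i).2 t ht⟩

theorem apply {ι : Type*} [Fintype ι] {x v : ℝ → ι → ℝ} (h : SolvesODE x v) (i : ι) :
    SolvesODE (fun t => x t i) (fun t => v t i) :=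
  ⟨continuousOn_pi.1 h.1 i, fun t ht => hasDerivWithinAt_pi.1 (h.2 t ht) i⟩

/-- A function which starts below the level `B` and cannot increase while it is above that level
remains below it. -/
theorem le_of_nonpos {x v : ℝ → ℝ} {B : ℝ} (hx : SolvesODE x v) (h0 : x 0 ≤ B)
    (h : ∀ t, 0 ≤ t → B < x t → v t ≤ 0) {t : ℝ} (ht : 0 ≤ t) : x t ≤ B := by
  -- the fence `B + ε (1 + s)` has positive slope, hence is never crossed; then `ε → 0`
  have key : ∀ ε > 0, x t ≤ B + ε * (1 + t) := by
    intro ε hε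
    refine image_le_of_deriv_right_lt_deriv_boundary (f := x) (f' := v) (a := 0) (b := t)
      (B := fun s => B + ε * (1 + s)) (B' := fun _ => ε)
      (hx.1.mono Icc_subset_Ici_self) (fun s hs => hx.2 s hs.1) (by simp; linarith) (fun s => ?_)
      (fun s hs hsB => ?_) ⟨ht, le_rfl⟩
    · simpa using (((hasDerivAt_id s).const_add 1).const_mul ε).const_add B
    · exact (h s hs.1 (by rw [hsB]; nlinarith [hs.1])).trans_lt hε
  refine le_of_forall_pos_le_add fun δ hδ => ?_
  have h1 : 0 < 1 + t := by linarith
  simpa [div_mul_cancel₀ δ h1.ne'] using key (δ / (1 + t)) (by positivity)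

theorem le_of_forall_nonpos {x v : ℝ → ℝ} (hx : SolvesODE x v) (h : ∀ t, 0 ≤ t → v t ≤ 0)
    {t : ℝ} (ht : 0 ≤ t) : x t ≤ x 0 :=
  hx.le_of_nonpos le_rfl (fun s hs _ => h s hs) ht

theorem ge_of_nonneg {x v : ℝ → ℝ} {B : ℝ} (hx : SolvesODE x v) (h0 : B ≤ x 0)
    (h : ∀ t, 0 ≤ t → x t < B → 0 ≤ v t) {t : ℝ} (ht : 0 ≤ t) : B ≤ x t := by
  have := hx.neg.le_of_nonpos (B := -B) (by simpa using h0)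
    (fun s hs hB => by simpa using h s hs (by simpa using hB)) ht
  simpa using this

theorem mono_of_nonneg {x v : ℝ → ℝ} (hx : SolvesODE x v) (h : ∀ t, 0 ≤ t → 0 ≤ v t) {s t : ℝ}
    (hs : 0 ≤ s) (hst : s ≤ t) : x s ≤ x t :=
  image_le_of_deriv_right_le_deriv_boundary (f := fun _ => x s) (f' := fun _ => 0) (a := s) (b := t)
    continuousOn_const (fun _ _ => hasDerivWithinAt_const _ _ _) le_rfl
    (hx.1.mono fun _ hr => hs.trans hr.1) (fun r hr => hx.2 r (hs.trans hr.1))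
    (fun r hr => h r (hs.trans hr.1)) ⟨hst, le_rfl⟩

theorem eq_of_zero {x : ℝ → E} (hx : SolvesODE x fun _ => 0) {t : ℝ} (ht : 0 ≤ t) : x t = x 0 :=
  constant_of_has_deriv_right_zero (hx.1.mono Icc_subset_Ici_self) (fun s hs => hx.2 s hs.1) t
    ⟨ht, le_rfl⟩

theorem eq_zero_of_norm_le {x v : ℝ → E} {k : ℝ → ℝ} (hx : SolvesODE x v) (h0 : x 0 = 0)
    (hk : ContinuousOn k (Ici 0)) (h : ∀ t, 0 ≤ t → ‖v t‖ ≤ k t * ‖x t‖) {t : ℝ} (ht : 0 ≤ t) :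
    x t = 0 := by
  obtain ⟨K, hK⟩ := isCompact_Icc.bddAbove_image (hk.mono (Icc_subset_Ici_self : Icc 0 t ⊆ Ici 0))
  refine eq_zero_of_abs_deriv_le_mul_abs_self_of_eq_zero_right (K := K) (a := 0) (b := t)
    (hx.1.mono Icc_subset_Ici_self) (fun s hs => hx.2 s hs.1) h0 (fun s hs => ?_) t ⟨ht, le_rfl⟩
  exact (h s hs.1).trans (mul_le_mul_of_nonneg_right
    (hK (mem_image_of_mem k (Ico_subset_Icc_self hs))) (norm_nonneg _))

/-- The fundamental theorem of calculus for right-continuous integrands. -/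
theorem integral [CompleteSpace E] {v : ℝ → E} (hv : LocallyIntegrableOn v (Ici 0))
    (hr : ∀ t, 0 ≤ t → ContinuousWithinAt v (Ici t) t) :
    SolvesODE (fun t => ∫ s in (0 : ℝ)..t, v s) v := by
  have hI : ∀ t, 0 ≤ t → IntervalIntegrable v volume 0 t := fun t ht =>
    (intervalIntegrable_iff_integrableOn_Icc_of_le ht).2
      (hv.integrableOn_compact_subset Icc_subset_Ici_self isCompact_Icc)
  refine ⟨fun t ht => ?_, fun t ht => ?_⟩
  · have h1 : IntegrableOn v (uIcc 0 (t + 1)) := by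
      rw [uIcc_of_le (by linarith [mem_Ici.1 ht])]
      exact hv.integrableOn_compact_subset Icc_subset_Ici_self isCompact_Icc
    have h2 := intervalIntegral.continuousOn_primitive_interval h1
    rw [uIcc_of_le (by linarith [mem_Ici.1 ht])] at h2
    have h3 := h2 t ⟨ht, by linarith⟩
    refine h3.mono_of_mem_nhdsWithin ?_
    rw [mem_nhdsWithin]
    exact ⟨Iio (t + 1), isOpen_Iio, by simp, fun s hs => ⟨hs.2, le_of_lt hs.1⟩⟩
  · refine intervalIntegral.integral_hasDerivWithinAt_right (hI t ht) (t := Ioi t) ?_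
      ((hr t ht).mono Ioi_subset_Ici_self)
    refine ⟨Ioo t (t + 1), Ioo_mem_nhdsGT (by linarith), ?_⟩
    have h1 : IntegrableOn v (Icc 0 (t + 1)) :=
      hv.integrableOn_compact_subset Icc_subset_Ici_self isCompact_Icc
    exact (h1.mono_set fun s hs => ⟨ht.trans hs.1.le, hs.2.le⟩).aestronglyMeasurable

theorem integral_of_continuousOn [CompleteSpace E] {v : ℝ → E} (hv : ContinuousOn v (Ici 0)) :
    SolvesODE (fun t => ∫ s in (0 : ℝ)..t, v s) v :=
  integral (hv.locallyIntegrableOn measurableSet_Ici)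
    fun t ht => (hv t ht).mono (Ici_subset_Ici.2 ht)

theorem eq_mul_exp {x k : ℝ → ℝ} (hk : ContinuousOn k (Ici 0))
    (hx : SolvesODE x fun t => -(k t * x t)) {t : ℝ} (ht : 0 ≤ t) :
    x t = x 0 * Real.exp (-∫ s in (0 : ℝ)..t, k s) := by
  have h := hx.mul (integral_of_continuousOn hk).exp
  have h1 := (h.congr (w := fun _ => 0) fun t _ => by ring).eq_of_zero ht
  simp only [intervalIntegral.integral_same, Real.exp_zero, mul_one] at h1
  rw [← h1, mul_assoc, ← Real.exp_add]
  simp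

end SolvesODE

theorem exists_solvesODE [CompleteSpace E] {f : ℝ → E → E}
    (hcont : ∀ x, ContinuousOn (fun t => f t x) (Ici 0))
    (hlip : ∀ n : ℝ, 0 ≤ n → ∃ K : NNReal, ∀ t ∈ Icc 0 n, LipschitzWith K (f t))
    (hbdd : ∀ n : ℝ, 0 ≤ n → ∃ L : NNReal, ∀ t ∈ Icc 0 n, ∀ x, ‖f t x‖ ≤ L) (x₀ : E) :
    ∃ x : ℝ → E, x 0 = x₀ ∧ SolvesODE x fun t => f t (x t) := by
  have hloc : ∀ n : ℝ, 0 ≤ n → ∃ x : ℝ → E, x 0 = x₀ ∧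
      ∀ t ∈ Icc 0 n, HasDerivWithinAt x (f t (x t)) (Icc 0 n) t := by
    intro n hn
    obtain ⟨K, hK⟩ := hlip n hn
    obtain ⟨L, hL⟩ := hbdd n hn
    have hPL : IsPicardLindelof f (tmin := 0) (tmax := n) ⟨0, le_rfl, hn⟩ x₀ (L * n.toNNReal) 0 L K :=
      { lipschitzOnWith := fun t ht => (hK t ht).lipschitzOnWith
        continuousOn := fun x _ => (hcont x).mono Icc_subset_Ici_self
        norm_le := fun t ht x _ => hL t ht x
        mul_max_le := by simp [hn] }
    exact hPL.exists_eq_forall_mem_Icc_hasDerivWithinAt₀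
  have hr : ∀ {n : ℝ} {x : ℝ → E},
      (∀ t ∈ Icc 0 n, HasDerivWithinAt x (f t (x t)) (Icc 0 n) t) →
      ∀ t ∈ Ico 0 n, HasDerivWithinAt x (f t (x t)) (Ici t) t := by
    intro n x h t ht
    refine (h t ⟨ht.1, ht.2.le⟩).mono_of_mem_nhdsWithin ?_
    rw [mem_nhdsWithin]
    exact ⟨Iio n, isOpen_Iio, ht.2, fun s hs => ⟨ht.1.trans hs.2, le_of_lt hs.1⟩⟩
  choose! X hX0 hX using hloc
  have huniq : ∀ {m n : ℝ}, 0 ≤ m → m ≤ n → EqOn (X m) (X n) (Icc 0 m) := by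
    intro m n hm hmn
    obtain ⟨K, hK⟩ := hlip m hm
    have hn := hm.trans hmn
    have hsub : Icc 0 m ⊆ Icc 0 n := Icc_subset_Icc_right hmn
    exact ODE_solution_unique_of_mem_Icc_right (v := f) (s := fun _ => univ) (K := K)
      (fun t ht => (hK t ⟨ht.1, ht.2.le⟩).lipschitzOnWith)
      (fun t ht => (hX m hm t ht).continuousWithinAt)
      (hr (hX m hm)) (fun _ _ => mem_univ _)
      (fun t ht => ((hX n hn t (hsub ht)).mono hsub).continuousWithinAt)
      (fun t ht => hr (hX n hn) t ⟨ht.1, ht.2.trans_le hmn⟩) (fun _ _ => mem_univ _)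
      (by rw [hX0 m hm, hX0 n hn])
  have heq : ∀ n : ℝ, 0 ≤ n → EqOn (fun t => X t t) (X n) (Icc 0 n) := fun n _ t ht =>
    huniq ht.1 ht.2 ⟨ht.1, le_rfl⟩
  refine ⟨fun t => X t t, hX0 0 le_rfl, fun t ht => ?_, fun t ht => ?_⟩
  all_goals
    have ht' : 0 ≤ t := ht
    have hn : (0 : ℝ) ≤ t + 1 := by linarith
    have htn : t ∈ Icc 0 (t + 1) := ⟨ht, by linarith⟩
    have h1 : HasDerivWithinAt (fun t => X t t) (f t (X t t)) (Icc 0 (t + 1)) t := by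
      have h2 := heq (t + 1) hn htn
      simp only at h2
      rw [h2]
      exact (hX (t + 1) hn t htn).congr (heq (t + 1) hn) h2
  · refine h1.continuousWithinAt.mono_of_mem_nhdsWithin ?_
    rw [mem_nhdsWithin]
    exact ⟨Iio (t + 1), isOpen_Iio, by simp, fun s hs => ⟨hs.2, le_of_lt hs.1⟩⟩
  · refine h1.mono_of_mem_nhdsWithin ?_
    rw [mem_nhdsWithin]
    exact ⟨Iio (t + 1), isOpen_Iio, by simp, fun s hs => ⟨ht.trans hs.2, le_of_lt hs.1⟩⟩

end ODE

/-! ### Quadratic forms and the spectral norm -/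

section Matrices

open scoped Matrix Matrix.Norms.L2Operator

variable {n : Type*} [Fintype n]

theorem dotProduct_sq_le (x y : n → ℝ) : (x ⬝ᵥ y) ^ 2 ≤ (x ⬝ᵥ x) * (y ⬝ᵥ y) := by
  simpa [dotProduct, sq] using Finset.sum_mul_sq_le_sq_mul_sq Finset.univ x y

theorem dotProduct_self_nonneg_real (x : n → ℝ) : 0 ≤ x ⬝ᵥ x :=
  Finset.sum_nonneg fun i _ => mul_self_nonneg (x i)

theorem norm_toLp_sq (x : n → ℝ) : ‖WithLp.toLp 2 x‖ ^ 2 = x ⬝ᵥ x := by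
  rw [EuclideanSpace.real_norm_sq_eq]
  simp [dotProduct, sq]

variable [DecidableEq n] {A F G Q : Matrix n n ℝ}

theorem dotProduct_mulVec_self_le (A : Matrix n n ℝ) (x : n → ℝ) :
    (A *ᵥ x) ⬝ᵥ (A *ᵥ x) ≤ ‖A‖ ^ 2 * (x ⬝ᵥ x) := by
  rw [← norm_toLp_sq, ← norm_toLp_sq, ← mul_pow]
  exact pow_le_pow_left₀ (norm_nonneg _) (A.l2_opNorm_mulVec (WithLp.toLp 2 x)) 2

theorem opNorm_le_of_dotProduct_le {K : ℝ} (hK : 0 ≤ K)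
    (h : ∀ x, (A *ᵥ x) ⬝ᵥ (A *ᵥ x) ≤ K ^ 2 * (x ⬝ᵥ x)) : ‖A‖ ≤ K := by
  rw [Matrix.cstar_norm_def]
  refine ContinuousLinearMap.opNorm_le_bound _ hK fun x => ?_
  refine le_of_sq_le_sq ?_ (by positivity)
  have h1 := h x.ofLp
  rw [← norm_toLp_sq, ← norm_toLp_sq, ← mul_pow] at h1
  exact h1

theorem abs_entry_le_opNorm (A : Matrix n n ℝ) (i j : n) : |A i j| ≤ ‖A‖ := by
  refine abs_le_of_sq_le_sq ?_ (norm_nonneg _)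
  have h := dotProduct_mulVec_self_le A (Pi.single j 1)
  have h1 : A i j ^ 2 ≤ (A *ᵥ Pi.single j 1) ⬝ᵥ (A *ᵥ Pi.single j 1) := by
    simp only [Matrix.mulVec_single_one, dotProduct]
    rw [sq]
    exact Finset.single_le_sum (f := fun k => A.col j k * A.col j k)
      (fun k _ => mul_self_nonneg _) (Finset.mem_univ i)
  simpa using h1.trans h

theorem dotProduct_mulVec_le (A : Matrix n n ℝ) (x : n → ℝ) :
    x ⬝ᵥ (A *ᵥ x) ≤ ‖A‖ * (x ⬝ᵥ x) := by
  refine le_of_sq_le_sq ?_ (mul_nonneg (norm_nonneg _) (dotProduct_self_nonneg_real x))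
  calc (x ⬝ᵥ (A *ᵥ x)) ^ 2 ≤ (x ⬝ᵥ x) * ((A *ᵥ x) ⬝ᵥ (A *ᵥ x)) := dotProduct_sq_le _ _
    _ ≤ (x ⬝ᵥ x) * (‖A‖ ^ 2 * (x ⬝ᵥ x)) :=
      mul_le_mul_of_nonneg_left (dotProduct_mulVec_self_le A x) (dotProduct_self_nonneg_real x)
    _ = (‖A‖ * (x ⬝ᵥ x)) ^ 2 := by ring

/-- For a symmetric matrix `0 ≤ F ≤ M` the spectral norm is at most `M`. -/
theorem opNorm_le_of_form_le {M : ℝ} (hM : 0 ≤ M) (hF : Fᵀ = F)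
    (h0 : ∀ x, 0 ≤ x ⬝ᵥ (F *ᵥ x)) (h1 : ∀ x, x ⬝ᵥ (F *ᵥ x) ≤ M * (x ⬝ᵥ x)) : ‖F‖ ≤ M := by
  refine opNorm_le_of_dotProduct_le hM fun x => ?_
  have hcs := LinearMap.BilinForm.apply_mul_apply_le_of_forall_zero_le (Matrix.toBilin' F)
    (fun y => by simpa [Matrix.toBilin'_apply'] using h0 y) (F *ᵥ x) x
  simp only [Matrix.toBilin'_apply'] at hcs
  have hsym : x ⬝ᵥ (F *ᵥ (F *ᵥ x)) = (F *ᵥ x) ⬝ᵥ (F *ᵥ x) := by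
    rw [Matrix.dotProduct_mulVec, ← Matrix.mulVec_transpose, hF]
  rw [hsym] at hcs
  set a := (F *ᵥ x) ⬝ᵥ (F *ᵥ x)
  have ha : 0 ≤ a := dotProduct_self_nonneg_real _
  have h2 : a * a ≤ a * (M ^ 2 * (x ⬝ᵥ x)) :=
    calc a * a ≤ _ := hcs
      _ ≤ (M * a) * (M * (x ⬝ᵥ x)) :=
        mul_le_mul (h1 _) (h1 x) (h0 x) (mul_nonneg hM ha)
      _ = a * (M ^ 2 * (x ⬝ᵥ x)) := by ring
  rcases ha.eq_or_lt with h | h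
  · rw [← h]
    exact mul_nonneg (sq_nonneg M) (dotProduct_self_nonneg_real x)
  · exact le_of_mul_le_mul_left h2 h

/-- Bounds for the inverse of a matrix `Q ≥ q`. -/
theorem inverse_bounds {q : ℝ} (hq : 0 < q) (hQ : ∀ x, q * (x ⬝ᵥ x) ≤ x ⬝ᵥ (Q *ᵥ x))
    (hGQ : G * Q = 1) (x : n → ℝ) :
    0 ≤ x ⬝ᵥ (G *ᵥ x) ∧ q * (x ⬝ᵥ (G *ᵥ x)) ≤ x ⬝ᵥ x ∧
      q ^ 2 * ((G *ᵥ x) ⬝ᵥ (G *ᵥ x)) ≤ x ⬝ᵥ x := by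
  have h1 := hQ (G *ᵥ x)
  rw [Matrix.mulVec_mulVec, mul_eq_one_comm.1 hGQ, Matrix.one_mulVec,
    dotProduct_comm (G *ᵥ x) x] at h1
  have h2 := dotProduct_sq_le x (G *ᵥ x)
  have ha := dotProduct_self_nonneg_real (G *ᵥ x)
  have hc := dotProduct_self_nonneg_real x
  set a := (G *ᵥ x) ⬝ᵥ (G *ᵥ x)
  set b := x ⬝ᵥ (G *ᵥ x)
  set c := x ⬝ᵥ x
  have hb : 0 ≤ b := (mul_nonneg hq.le ha).trans h1
  have h3 : q * b ≤ c := by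
    rcases hb.eq_or_lt with h | h
    · rw [← h]; simpa using hc
    · refine le_of_mul_le_mul_left ?_ h
      calc b * (q * b) = q * b ^ 2 := by ring
        _ ≤ q * (c * a) := mul_le_mul_of_nonneg_left h2 hq.le
        _ = c * (q * a) := by ring
        _ ≤ c * b := mul_le_mul_of_nonneg_left h1 hc
        _ = b * c := mul_comm _ _
  exact ⟨hb, h3, by nlinarith⟩

theorem opNorm_inverse_le {q : ℝ} (hq : 0 < q) (hQ : ∀ x, q * (x ⬝ᵥ x) ≤ x ⬝ᵥ (Q *ᵥ x))
    (hGQ : G * Q = 1) : ‖G‖ ≤ 1 / q := by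
  refine opNorm_le_of_dotProduct_le (by positivity) fun x => ?_
  have h := (inverse_bounds hq hQ hGQ x).2.2
  rw [div_pow, one_pow, div_mul_eq_mul_div, one_mul, le_div_iff₀ (by positivity)]
  linarith

theorem isUnit_of_coercive {q : ℝ} (hq : 0 < q)
    (hQ : ∀ x, q * (x ⬝ᵥ x) ≤ x ⬝ᵥ (Q *ᵥ x)) : IsUnit Q := by
  rw [← Matrix.mulVec_injective_iff_isUnit]
  intro x y hxy
  have h0 : Q *ᵥ (x - y) = 0 := by rw [Matrix.mulVec_sub]; exact sub_eq_zero.2 hxy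
  have h := hQ (x - y)
  rw [h0, dotProduct_zero] at h
  have h1 : (x - y) ⬝ᵥ (x - y) = 0 :=
    le_antisymm (by nlinarith) (dotProduct_self_nonneg_real _)
  exact sub_eq_zero.1 (dotProduct_self_eq_zero.1 h1)

/-- A symmetric matrix `c ≤ S ≤ 1` has determinant between `c ^ n` and `1`. -/
theorem det_bounds {S : Matrix n n ℝ} {c : ℝ} (hc : 0 ≤ c) (hS : Sᵀ = S)
    (h0 : ∀ x, c * (x ⬝ᵥ x) ≤ x ⬝ᵥ (S *ᵥ x)) (h1 : ∀ x, x ⬝ᵥ (S *ᵥ x) ≤ x ⬝ᵥ x) :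
    c ^ Fintype.card n ≤ S.det ∧ S.det ≤ 1 := by
  have hH : S.IsHermitian := by rw [Matrix.IsHermitian, Matrix.conjTranspose_eq_transpose_of_trivial, hS]
  have hunit : ∀ i, (hH.eigenvectorBasis i).ofLp ⬝ᵥ (hH.eigenvectorBasis i).ofLp = 1 := by
    intro i
    rw [← norm_toLp_sq]
    simp
  have heig : ∀ i, hH.eigenvalues i =
      (hH.eigenvectorBasis i).ofLp ⬝ᵥ (S *ᵥ (hH.eigenvectorBasis i).ofLp) := by
    intro i
    rw [hH.eigenvalues_eq]
    simp
  have hlo : ∀ i, c ≤ hH.eigenvalues i := fun i => by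
    have := h0 (hH.eigenvectorBasis i).ofLp
    rwa [hunit, mul_one, ← heig] at this
  have hhi : ∀ i, hH.eigenvalues i ≤ 1 := fun i => by
    have := h1 (hH.eigenvectorBasis i).ofLp
    rwa [hunit, ← heig] at this
  rw [hH.det_eq_prod_eigenvalues]
  simp only [RCLike.ofReal_real_eq_id, id]
  constructor
  · rw [← Finset.card_univ, ← Finset.prod_const]
    exact Finset.prod_le_prod (fun _ _ => hc) fun i _ => hlo i
  · exact Finset.prod_le_one (fun i _ => hc.trans (hlo i)) fun i _ => hhi i

/-- On the matrices `Q ≥ q` the function `Q ↦ ‖Q⁻¹‖` is bounded and Lipschitz, hence it has a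
bounded Lipschitz extension to all matrices. -/
theorem exists_lipschitz_norm_inverse {q : ℝ} (hq : 0 < q) :
    ∃ (h : Matrix n n ℝ → ℝ) (K : NNReal), LipschitzWith K h ∧ (∀ Q, 0 ≤ h Q ∧ h Q ≤ 1 / q) ∧
      ∀ Q, (∀ x, q * (x ⬝ᵥ x) ≤ x ⬝ᵥ (Q *ᵥ x)) → h Q = ‖Q⁻¹‖ := by
  have hinv : ∀ Q : Matrix n n ℝ, (∀ x, q * (x ⬝ᵥ x) ≤ x ⬝ᵥ (Q *ᵥ x)) →
      ‖Q⁻¹‖ ≤ 1 / q ∧ Q⁻¹ * Q = 1 := fun Q hQ => by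
    have h1 : Q⁻¹ * Q = 1 :=
      Matrix.nonsing_inv_mul _ ((Matrix.isUnit_iff_isUnit_det _).1 (isUnit_of_coercive hq hQ))
    exact ⟨opNorm_inverse_le hq hQ h1, h1⟩
  have hL : LipschitzOnWith (Real.toNNReal ((1 / q) ^ 2)) (fun Q : Matrix n n ℝ => ‖Q⁻¹‖)
      {Q | ∀ x, q * (x ⬝ᵥ x) ≤ x ⬝ᵥ (Q *ᵥ x)} := by
    refine LipschitzOnWith.of_dist_le_mul fun A hA B hB => ?_
    rw [Real.coe_toNNReal _ (by positivity), Real.dist_eq, dist_eq_norm]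
    obtain ⟨hA1, hA2⟩ := hinv A hA
    obtain ⟨hB1, hB2⟩ := hinv B hB
    have hd : A⁻¹ - B⁻¹ = A⁻¹ * (B - A) * B⁻¹ := by
      rw [mul_sub, hA2, sub_mul, one_mul, mul_assoc, mul_eq_one_comm.1 hB2, mul_one]
    calc |‖A⁻¹‖ - ‖B⁻¹‖| ≤ ‖A⁻¹ - B⁻¹‖ := abs_norm_sub_norm_le _ _
      _ ≤ ‖A⁻¹‖ * ‖B - A‖ * ‖B⁻¹‖ := by
        rw [hd]
        exact (norm_mul_le _ _).trans
          (mul_le_mul_of_nonneg_right (norm_mul_le _ _) (norm_nonneg _))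
      _ ≤ 1 / q * ‖B - A‖ * (1 / q) := by gcongr
      _ = (1 / q) ^ 2 * ‖A - B‖ := by rw [norm_sub_rev]; ring
  obtain ⟨h, hh, heq⟩ := hL.extend_real
  refine ⟨fun Q => max 0 (min (h Q) (1 / q)), _, (hh.min_const (1 / q)).const_max 0,
    fun Q => ⟨le_max_left _ _, max_le (by positivity) (min_le_right _ _)⟩, fun Q hQ => ?_⟩
  change max 0 (min (h Q) (1 / q)) = ‖Q⁻¹‖
  rw [← heq hQ, min_eq_left (hinv Q hQ).1, max_eq_right (norm_nonneg _)]

theorem SolvesODE.matrix_inv {Q Q' : ℝ → Matrix n n ℝ} (hQ : SolvesODE Q Q')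
    (hu : ∀ t, 0 ≤ t → IsUnit (Q t)) :
    SolvesODE (fun t => (Q t)⁻¹) (fun t => -((Q t)⁻¹ * Q' t * (Q t)⁻¹)) := by
  have key : ∀ t, 0 ≤ t → HasFDerivAt (fun A : Matrix n n ℝ => A⁻¹)
      (-ContinuousLinearMap.mulLeftRight ℝ _ (Q t)⁻¹ (Q t)⁻¹) (Q t) := by
    intro t ht
    obtain ⟨U, hU⟩ := hu t ht
    have h := hasFDerivAt_ringInverse (𝕜 := ℝ) U
    have hf : (fun A : Matrix n n ℝ => A⁻¹) = Ring.inverse :=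
      funext fun A => Matrix.nonsing_inv_eq_ringInverse A
    rw [hf, ← hU, ← Matrix.coe_units_inv]
    exact h
  exact ⟨fun t ht => (key t ht).continuousAt.comp_continuousWithinAt (hQ.1 t ht), fun t ht => by
    simpa [Function.comp_def] using (key t ht).comp_hasDerivWithinAt t (hQ.2 t ht)⟩

theorem SolvesODE.entry {A A' : ℝ → Matrix n n ℝ} (h : SolvesODE A A') (i j : n) :
    SolvesODE (fun t => A t i j) (fun t => A' t i j) :=
  h.clm (LinearMap.toContinuousLinearMap (Matrix.entryLinearMap ℝ ℝ i j))

theorem SolvesODE.of_entry {A A' : ℝ → Matrix n n ℝ}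
    (h : ∀ i j, SolvesODE (fun t => A t i j) (fun t => A' t i j)) : SolvesODE A A' := by
  have h1 : SolvesODE (fun t => ∑ i, ∑ j, A t i j • Matrix.single i j (1 : ℝ))
      (fun t => ∑ i, ∑ j, (A t i j • (0 : Matrix n n ℝ) + A' t i j • Matrix.single i j (1 : ℝ))) :=
    SolvesODE.sum _ fun i _ => SolvesODE.sum _ fun j _ => (h i j).smul (SolvesODE.const _)
  refine (h1.congr_left fun t _ => ?_).congr fun t _ => ?_
  · conv_rhs => rw [Matrix.matrix_eq_sum_single (A t)]
    simp
  · conv_rhs => rw [Matrix.matrix_eq_sum_single (A' t)]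
    simp

theorem SolvesODE.mulVec {A A' : ℝ → Matrix n n ℝ} {x x' : ℝ → n → ℝ} (hA : SolvesODE A A')
    (hx : SolvesODE x x') :
    SolvesODE (fun t => A t *ᵥ x t) (fun t => A' t *ᵥ x t + A t *ᵥ x' t) := by
  refine SolvesODE.pi fun i => ?_
  refine (SolvesODE.sum Finset.univ fun j _ => (hA.entry i j).mul (hx.apply j)).congr fun t _ => ?_
  simp [Matrix.mulVec, dotProduct, Finset.sum_add_distrib]

theorem SolvesODE.form {A A' : ℝ → Matrix n n ℝ} (hA : SolvesODE A A') (x : n → ℝ) :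
    SolvesODE (fun t => x ⬝ᵥ (A t *ᵥ x)) (fun t => x ⬝ᵥ (A' t *ᵥ x)) := by
  refine (SolvesODE.sum Finset.univ fun i _ =>
    ((hA.mulVec (SolvesODE.const x)).apply i).const_mul (x i)).congr fun t _ => ?_
  simp [dotProduct]

end Matrices

/-! ### Least squares with forgetting -/

section LeastSquares

open scoped Matrix Matrix.Norms.L2Operator

/-- The least-squares part of the estimator, driven by the noise-free regression `y = φ ⬝ᵥ μ`. -/
structure LeastSquares (g : Gains) (μ : Fin 5 → ℝ) (φ : ℝ → Fin 5 → ℝ)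
    (F : ℝ → Matrix (Fin 5) (Fin 5) ℝ) (z : ℝ → ℝ) (μh : ℝ → Fin 5 → ℝ) : Prop where
  cont : ContinuousOn φ (Ici 0)
  F_init : F 0 = (1 / g.f₀) • 1
  z_init : z 0 = 1
  mu_init : μh 0 = g.μ₀
  F_ode : SolvesODE F fun t =>
    -(g.α • (F t * Matrix.vecMulVec (φ t) (φ t) * F t)) + (g.β₀ * (1 - ‖F t‖ / g.M)) • F t
  z_ode : SolvesODE z fun t => -(g.β₀ * (1 - ‖F t‖ / g.M) * z t)
  mu_ode : SolvesODE μh fun t =>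
    (g.α * (φ t ⬝ᵥ μ - φ t ⬝ᵥ μh t)) • (F t *ᵥ φ t)

/-- The information matrix `f₀ I + ∫ (α / z) φ φᵀ`, which turns out to be the inverse of `z F`. -/
def information (g : Gains) (φ : ℝ → Fin 5 → ℝ) (z : ℝ → ℝ) (t : ℝ) : Matrix (Fin 5) (Fin 5) ℝ :=
  g.f₀ • 1 + ∫ s in (0 : ℝ)..t, (g.α / z s) • Matrix.vecMulVec (φ s) (φ s)

theorem continuousOn_vecMulVec {φ : ℝ → Fin 5 → ℝ} {s : Set ℝ} (h : ContinuousOn φ s) :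
    ContinuousOn (fun t => Matrix.vecMulVec (φ t) (φ t)) s :=
  (continuous_id.matrix_vecMulVec continuous_id : Continuous fun x : Fin 5 → ℝ =>
    Matrix.vecMulVec x x).comp_continuousOn h

theorem information_init (g : Gains) (φ : ℝ → Fin 5 → ℝ) (z : ℝ → ℝ) :
    information g φ z 0 = g.f₀ • 1 := by
  simp [information]

section

variable {g : Gains} {φ : ℝ → Fin 5 → ℝ} {z : ℝ → ℝ}

theorem information_ode (hφ : ContinuousOn φ (Ici 0)) (hz : ContinuousOn z (Ici 0))
    (hz0 : ∀ t, 0 ≤ t → 0 < z t) :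
    SolvesODE (information g φ z) fun t => (g.α / z t) • Matrix.vecMulVec (φ t) (φ t) := by
  have hc : ContinuousOn (fun t => (g.α / z t) • Matrix.vecMulVec (φ t) (φ t)) (Ici 0) :=
    (continuousOn_const.div hz fun t ht => (hz0 t ht).ne').smul (continuousOn_vecMulVec hφ)
  exact ((SolvesODE.const (g.f₀ • (1 : Matrix (Fin 5) (Fin 5) ℝ))).add
    (SolvesODE.integral_of_continuousOn hc)).congr fun t _ => zero_add _

/-- Any solution of the information dynamics is symmetric. -/
theorem transpose_eq_of_ode {Q : ℝ → Matrix (Fin 5) (Fin 5) ℝ} {a : ℝ → ℝ} {f : ℝ}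
    (hQ0 : Q 0 = f • 1) (hQ : SolvesODE Q fun t => a t • Matrix.vecMulVec (φ t) (φ t))
    {t : ℝ} (ht : 0 ≤ t) : (Q t)ᵀ = Q t := by
  ext i j
  have h := (((hQ.entry j i).sub (hQ.entry i j)).congr (w := fun _ => 0) fun t _ => by
    simp [Matrix.vecMulVec_apply]; ring).eq_of_zero ht
  rw [hQ0] at h
  have h1 : Q t j i - Q t i j = 0 := by
    rw [h]; simp [Matrix.one_apply, eq_comm]
  simpa [sub_eq_zero] using h1

theorem form_vecMulVec (x y : Fin 5 → ℝ) :
    x ⬝ᵥ (Matrix.vecMulVec y y *ᵥ x) = (y ⬝ᵥ x) ^ 2 := by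
  rw [Matrix.vecMulVec_mulVec]
  simp [dotProduct_comm x y, sq]

/-- The information dynamics never decrease the quadratic form. -/
theorem coercive_of_ode {Q : ℝ → Matrix (Fin 5) (Fin 5) ℝ} {a : ℝ → ℝ} {f : ℝ}
    (hQ0 : Q 0 = f • 1) (hQ : SolvesODE Q fun t => a t • Matrix.vecMulVec (φ t) (φ t))
    (ha : ∀ t, 0 ≤ t → 0 ≤ a t) {t : ℝ} (ht : 0 ≤ t) (x : Fin 5 → ℝ) :
    f * (x ⬝ᵥ x) ≤ x ⬝ᵥ (Q t *ᵥ x) := by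
  refine (hQ.form x).ge_of_nonneg (by simp [hQ0, Matrix.smul_mulVec]) (fun s hs _ => ?_) ht
  rw [Matrix.smul_mulVec, dotProduct_smul, form_vecMulVec]
  exact mul_nonneg (ha s hs) (sq_nonneg _)

end

namespace LeastSquares

variable {g : Gains} {μ : Fin 5 → ℝ} {φ : ℝ → Fin 5 → ℝ} {F : ℝ → Matrix (Fin 5) (Fin 5) ℝ}
  {z : ℝ → ℝ} {μh : ℝ → Fin 5 → ℝ} {t : ℝ}

theorem z_pos (h : LeastSquares g μ φ F z μh) (ht : 0 ≤ t) : 0 < z t := by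
  have hk : ContinuousOn (fun t => g.β₀ * (1 - ‖F t‖ / g.M)) (Ici 0) :=
    continuousOn_const.mul (continuousOn_const.sub (h.F_ode.1.norm.div_const _))
  rw [h.z_ode.eq_mul_exp hk ht, h.z_init, one_mul]
  exact Real.exp_pos _

theorem info_ode (h : LeastSquares g μ φ F z μh) :
    SolvesODE (information g φ z) fun t => (g.α / z t) • Matrix.vecMulVec (φ t) (φ t) :=
  information_ode h.cont h.z_ode.1 fun _ ht => h.z_pos ht

theorem mul_info (h : LeastSquares g μ φ F z μh) (hg : g.Admissible) (ht : 0 ≤ t) :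
    (z t • F t) * information g φ z t = 1 := by
  have hf := hg.2.2.2.1
  -- the defect `E = 1 - z F Q` solves the linear equation `E' = -α F φ φᵀ E` with `E(0) = 0`
  have h1 := (SolvesODE.const (1 : Matrix (Fin 5) (Fin 5) ℝ)).sub
    ((h.z_ode.smul h.F_ode).mul h.info_ode)
  have h2 := h1.eq_zero_of_norm_le
    (k := fun t => ‖g.α • (F t * Matrix.vecMulVec (φ t) (φ t))‖) ?_ ?_ (fun s hs => ?_) ht
  · exact (sub_eq_zero.1 h2).symm
  · simp only [h.z_init, h.F_init, information_init]
    rw [one_smul, smul_mul_smul_comm, one_div_mul_cancel hf.ne', one_smul, one_mul, sub_self]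
  · exact ((h.F_ode.1.mul (continuousOn_vecMulVec h.cont)).const_smul g.α).norm
  · refine le_trans (le_of_eq ?_) (norm_mul_le _ _)
    rw [← norm_neg]
    congr 1
    have hz := (h.z_pos hs).ne'
    generalize g.β₀ * (1 - ‖F s‖ / g.M) = b
    simp only [smul_add, smul_neg, add_mul, neg_mul, smul_mul_assoc, mul_smul_comm, mul_sub,
      mul_one, smul_smul, neg_smul, mul_assoc, zero_sub, neg_neg]
    have e : g.α / z s * z s = g.α := by field_simp
    simp only [e, mul_comm (z s) g.α, mul_comm (z s) b]
    abel

theorem info_symm (h : LeastSquares g μ φ F z μh) (ht : 0 ≤ t) :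
    (information g φ z t)ᵀ = information g φ z t :=
  transpose_eq_of_ode (information_init g φ z) h.info_ode ht

theorem info_coercive (h : LeastSquares g μ φ F z μh) (hg : g.Admissible) (ht : 0 ≤ t)
    (x : Fin 5 → ℝ) : g.f₀ * (x ⬝ᵥ x) ≤ x ⬝ᵥ (information g φ z t *ᵥ x) :=
  coercive_of_ode (information_init g φ z) h.info_ode
    (fun _ hs => div_nonneg hg.2.1.le (h.z_pos hs).le) ht x

theorem F_symm (h : LeastSquares g μ φ F z μh) (hg : g.Admissible) (ht : 0 ≤ t) :
    (F t)ᵀ = F t := by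
  have h1 := h.mul_info hg ht
  have h2 : information g φ z t * (z t • (F t)ᵀ) = 1 := by
    have := congrArg Matrix.transpose h1
    rwa [Matrix.transpose_mul, h.info_symm ht, Matrix.transpose_smul, Matrix.transpose_one] at this
  have h3 : z t • (F t)ᵀ = z t • F t := by
    rw [← one_mul (z t • (F t)ᵀ), ← h1, mul_assoc, h2, mul_one]
  exact smul_right_injective _ (h.z_pos ht).ne' h3

theorem F_nonneg (h : LeastSquares g μ φ F z μh) (hg : g.Admissible) (ht : 0 ≤ t)
    (x : Fin 5 → ℝ) : 0 ≤ x ⬝ᵥ (F t *ᵥ x) := by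
  have h1 := (inverse_bounds hg.2.2.2.1 (h.info_coercive hg ht) (h.mul_info hg ht) x).1
  rw [Matrix.smul_mulVec, dotProduct_smul, smul_eq_mul] at h1
  exact nonneg_of_mul_nonneg_right h1 (h.z_pos ht)

theorem M_pos (hg : g.Admissible) : 0 < g.M :=
  (one_div_pos.2 hg.2.2.2.1).trans_le hg.2.2.2.2.1

/-- The forgetting factor keeps the gain matrix below the level `M`: where a quadratic form
`xᵀ F x` exceeds `M |x|²`, the norm of `F` exceeds `M`, and the form decreases. -/
theorem norm_F_le (h : LeastSquares g μ φ F z μh) (hg : g.Admissible) (ht : 0 ≤ t) :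
    ‖F t‖ ≤ g.M := by
  have hM := M_pos hg
  refine opNorm_le_of_form_le hM.le (h.F_symm hg ht) (h.F_nonneg hg ht) fun x => ?_
  refine (h.F_ode.form x).le_of_nonpos ?_ (fun s hs hlt => ?_) ht
  · rw [h.F_init, Matrix.smul_mulVec, dotProduct_smul, Matrix.one_mulVec, smul_eq_mul]
    exact mul_le_mul_of_nonneg_right hg.2.2.2.2.1 (dotProduct_self_nonneg_real x)
  · have hx : 0 < x ⬝ᵥ x := by
      refine lt_of_le_of_ne (dotProduct_self_nonneg_real x) fun h0 => ?_
      rw [dotProduct_self_eq_zero.1 h0.symm] at hlt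
      simp at hlt
    have hn : g.M < ‖F s‖ := lt_of_mul_lt_mul_right (hlt.trans_le (dotProduct_mulVec_le _ _)) hx.le
    have hb : g.β₀ * (1 - ‖F s‖ / g.M) ≤ 0 := by
      have : 1 < ‖F s‖ / g.M := (one_lt_div hM).2 hn
      exact mul_nonpos_of_nonneg_of_nonpos hg.2.2.1.le (by linarith)
    have hform : x ⬝ᵥ ((F s * Matrix.vecMulVec (φ s) (φ s) * F s) *ᵥ x)
        = (φ s ⬝ᵥ (F s *ᵥ x)) ^ 2 := by
      rw [← form_vecMulVec, ← Matrix.mulVec_mulVec, ← Matrix.mulVec_mulVec, Matrix.dotProduct_mulVec,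
        ← Matrix.mulVec_transpose, h.F_symm hg hs]
    rw [Matrix.add_mulVec, Matrix.neg_mulVec, Matrix.smul_mulVec, Matrix.smul_mulVec,
      dotProduct_add, dotProduct_neg, dotProduct_smul, dotProduct_smul, hform, smul_eq_mul,
      smul_eq_mul]
    have e1 := mul_nonneg hg.2.1.le (sq_nonneg (φ s ⬝ᵥ (F s *ᵥ x)))
    have e2 := mul_nonpos_of_nonpos_of_nonneg hb (h.F_nonneg hg hs x)
    linarith

theorem z_le_one (h : LeastSquares g μ φ F z μh) (hg : g.Admissible) (ht : 0 ≤ t) : z t ≤ 1 := by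
  rw [← h.z_init]
  refine h.z_ode.le_of_forall_nonpos (fun s hs => ?_) ht
  have h1 : ‖F s‖ / g.M ≤ 1 := (div_le_one (M_pos hg)).2 (h.norm_F_le hg hs)
  have := mul_nonneg (mul_nonneg hg.2.2.1.le (sub_nonneg.2 h1)) (h.z_pos hs).le
  linarith

/-- The estimation error equals `f₀ z F (μ⁰ - μ)`. -/
theorem muHat_eq (h : LeastSquares g μ φ F z μh) (hg : g.Admissible) (ht : 0 ≤ t) :
    μh t = μ + g.f₀ • ((z t • F t) *ᵥ (g.μ₀ - μ)) := by
  have h1 := (h.info_ode.mulVec (h.mu_ode.sub (SolvesODE.const μ))).congr (w := fun _ => 0) ?_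
  · have h2 := h1.eq_of_zero ht
    simp only [information_init, h.mu_init] at h2
    have h3 := congrArg (fun v => (z t • F t) *ᵥ v) h2
    simp only [Matrix.mulVec_mulVec, h.mul_info hg ht, Matrix.one_mulVec] at h3
    rw [mul_smul_comm, mul_one, Matrix.smul_mulVec] at h3
    rw [← h3]
    abel
  · intro s hs
    have hz := (h.z_pos hs).ne'
    have h2 : information g φ z s *ᵥ (F s *ᵥ φ s) = (1 / z s) • φ s := by
      have h3 := mul_eq_one_comm.1 (h.mul_info hg hs)
      rw [mul_smul_comm] at h3
      have h4 : information g φ z s * F s = (1 / z s) • 1 := by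
        rw [← h3, smul_smul, one_div_mul_cancel hz, one_smul]
      rw [Matrix.mulVec_mulVec, h4, Matrix.smul_mulVec, Matrix.one_mulVec]
    rw [Matrix.smul_mulVec, Matrix.vecMulVec_mulVec, sub_zero, Matrix.mulVec_smul, h2]
    ext i
    simp [dotProduct_sub]
    field_simp
    ring

/-- Interval excitation raises the information matrix above `f₀ + α c` once the interval is over. -/
theorem info_excited (h : LeastSquares g μ φ F z μh) (hg : g.Admissible) {c tc : ℝ} (htc : 0 < tc)
    (hIE : (Matrix.of (fun i j : Fin 5 => ∫ s in (0 : ℝ)..tc, φ s i * φ s j)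
      - c • (1 : Matrix (Fin 5) (Fin 5) ℝ)).PosSemidef) (ht : tc ≤ t) (x : Fin 5 → ℝ) :
    (g.f₀ + g.α * c) * (x ⬝ᵥ x) ≤ x ⬝ᵥ (information g φ z t *ᵥ x) := by
  have hα := hg.2.1
  have hz : ∀ s, 0 ≤ s → g.α ≤ g.α / z s := fun s hs =>
    (le_div_iff₀ (h.z_pos hs)).2 (mul_le_of_le_one_right hα.le (h.z_le_one hg hs))
  have hW : ∀ i j, SolvesODE (fun t => ∫ s in (0 : ℝ)..t, φ s i * φ s j)
      (fun s => φ s i * φ s j) := fun i j =>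
    SolvesODE.integral_of_continuousOn
      ((continuousOn_pi.1 h.cont i).mul (continuousOn_pi.1 h.cont j))
  have hWm : SolvesODE (fun t => Matrix.of (fun i j : Fin 5 => ∫ s in (0 : ℝ)..t, φ s i * φ s j))
      (fun t => Matrix.vecMulVec (φ t) (φ t)) := SolvesODE.of_entry hW
  have h1 : (g.f₀ + g.α * c) * (x ⬝ᵥ x) ≤ x ⬝ᵥ (information g φ z tc *ᵥ x) := by
    have h2 := (h.info_ode.form x).sub ((hWm.form x).const_mul g.α)
    have h3 := h2.ge_of_nonneg (B := g.f₀ * (x ⬝ᵥ x)) ?_ (fun s hs _ => ?_) htc.le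
    · have h4 := hIE.dotProduct_mulVec_nonneg x
      rw [Matrix.sub_mulVec, Matrix.smul_mulVec, Matrix.one_mulVec, dotProduct_sub,
        dotProduct_smul, smul_eq_mul, star_trivial] at h4
      have h5 := mul_le_mul_of_nonneg_left (sub_nonneg.1 h4) hα.le
      linarith
    · have h0 : (Matrix.of (fun _ _ : Fin 5 => (0 : ℝ))) = 0 := rfl
      simp [information_init, Matrix.smul_mulVec, h0]
    · rw [Matrix.smul_mulVec, dotProduct_smul, smul_eq_mul, form_vecMulVec, ← sub_mul]
      exact mul_nonneg (sub_nonneg.2 (hz s hs)) (sq_nonneg _)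
  refine h1.trans ((h.info_ode.form x).mono_of_nonneg (fun s hs => ?_) htc.le ht)
  rw [Matrix.smul_mulVec, dotProduct_smul, smul_eq_mul, form_vecMulVec]
  exact mul_nonneg (hα.le.trans (hz s hs)) (sq_nonneg _)

/-- If the information matrix exceeds `f₀ + w`, then `det (I - z f₀ F)` lies between
`(w / (f₀ + w)) ^ 5` and `1`. -/
theorem det_mix_bounds (h : LeastSquares g μ φ F z μh) (hg : g.Admissible) (ht : 0 ≤ t) {w : ℝ}
    (hw : 0 ≤ w)
    (hQ : ∀ x, (g.f₀ + w) * (x ⬝ᵥ x) ≤ x ⬝ᵥ (information g φ z t *ᵥ x)) :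
    (w / (g.f₀ + w)) ^ 5 ≤ (1 - (z t * g.f₀) • F t).det ∧ (1 - (z t * g.f₀) • F t).det ≤ 1 := by
  have hf := hg.2.2.2.1
  have hfw : 0 < g.f₀ + w := by linarith
  have hform : ∀ x, x ⬝ᵥ ((1 - (z t * g.f₀) • F t) *ᵥ x)
      = x ⬝ᵥ x - g.f₀ * (x ⬝ᵥ ((z t • F t) *ᵥ x)) := by
    intro x
    rw [Matrix.sub_mulVec, Matrix.one_mulVec, Matrix.smul_mulVec, Matrix.smul_mulVec, dotProduct_sub,
      dotProduct_smul, dotProduct_smul, smul_eq_mul, smul_eq_mul]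
    ring
  have hb := inverse_bounds hfw hQ (h.mul_info hg ht)
  refine det_bounds (S := 1 - (z t * g.f₀) • F t) (c := w / (g.f₀ + w)) (div_nonneg hw hfw.le) ?_ (fun x => ?_) (fun x => ?_)
  · rw [Matrix.transpose_sub, Matrix.transpose_one, Matrix.transpose_smul, h.F_symm hg ht]
  · rw [hform, div_mul_eq_mul_div, div_le_iff₀ hfw]
    nlinarith [(hb x).2.1]
  · rw [hform]
    nlinarith [(hb x).1]

/-- Mixing by the adjugate turns the vector regression into five scalar ones. -/
theorem mixing (h : LeastSquares g μ φ F z μh) (hg : g.Admissible) (ht : 0 ≤ t) :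
    (1 - (z t * g.f₀) • F t).adjugate *ᵥ (μh t - (z t * g.f₀) • (F t *ᵥ g.μ₀))
      = (1 - (z t * g.f₀) • F t).det • μ := by
  have h1 : μh t - (z t * g.f₀) • (F t *ᵥ g.μ₀) = (1 - (z t * g.f₀) • F t) *ᵥ μ := by
    rw [h.muHat_eq hg ht, Matrix.sub_mulVec, Matrix.one_mulVec, Matrix.smul_mulVec,
      Matrix.smul_mulVec, smul_smul, Matrix.mulVec_sub, mul_comm g.f₀, smul_sub]
    abel
  rw [h1, Matrix.mulVec_mulVec, Matrix.adjugate_mul, Matrix.smul_mulVec, Matrix.one_mulVec]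

end LeastSquares
end LeastSquares

/-! ### First-order filters -/

/-- A driving signal: locally integrable on `[0, ∞)` and continuous from the right. -/
structure Signal (v : ℝ → ℝ) : Prop where
  integrable : LocallyIntegrableOn v (Ici 0)
  right_cont : ∀ t : ℝ, 0 ≤ t → ContinuousWithinAt v (Ici t) t

namespace Signal

theorem of_continuousOn {v : ℝ → ℝ} (h : ContinuousOn v (Ici 0)) : Signal v :=
  ⟨h.locallyIntegrableOn measurableSet_Ici, fun t ht => (h t ht).mono (Ici_subset_Ici.2 ht)⟩

theorem add {v w : ℝ → ℝ} (hv : Signal v) (hw : Signal w) : Signal fun t => v t + w t :=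
  ⟨hv.1.add hw.1, fun t ht => (hv.2 t ht).add (hw.2 t ht)⟩

theorem sub {v w : ℝ → ℝ} (hv : Signal v) (hw : Signal w) : Signal fun t => v t - w t :=
  ⟨hv.1.sub hw.1, fun t ht => (hv.2 t ht).sub (hw.2 t ht)⟩

theorem mul {a v : ℝ → ℝ} (ha : ContinuousOn a (Ici 0)) (hv : Signal v) :
    Signal fun t => a t * v t :=
  ⟨(locallyIntegrableOn_iff isClosed_Ici.isLocallyClosed).2 fun _ hk hkc =>
      (hv.1.integrableOn_compact_subset hk hkc).continuousOn_mul (ha.mono hk) hkc,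
    fun t ht => ((ha t ht).mono (Ici_subset_Ici.2 ht)).mul (hv.2 t ht)⟩

theorem ode {v : ℝ → ℝ} (hv : Signal v) : SolvesODE (fun t => ∫ s in (0 : ℝ)..t, v s) v :=
  SolvesODE.integral hv.1 hv.2

theorem of_admissible {v : ℝ → ℝ} (hv : AdmissibleInfluent v) : Signal v := by
  obtain ⟨hm, ⟨b, hb⟩, hr⟩ := hv
  refine ⟨(locallyIntegrableOn_iff isClosed_Ici.isLocallyClosed).2 fun k hk hkc => ?_, hr⟩
  refine Measure.integrableOn_of_bounded (M := b) hkc.measure_lt_top.ne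
    hm.aestronglyMeasurable ?_
  exact (ae_restrict_iff' hkc.measurableSet).2 (Filter.Eventually.of_forall fun t ht => hb t (hk ht))

end Signal

theorem solvesODE_exp_mul (a : ℝ) :
    SolvesODE (fun t => Real.exp (a * t)) fun t => a * Real.exp (a * t) :=
  SolvesODE.of_hasDerivAt fun t => by
    simpa [mul_comm] using ((hasDerivAt_id t).const_mul a).exp

theorem continuous_exp_mul (a : ℝ) : Continuous fun t : ℝ => Real.exp (a * t) := by fun_prop

theorem lowpass_eq (lam : ℝ) (v : ℝ → ℝ) (t : ℝ) :
    lowpass lam v t = Real.exp (-lam * t) * ∫ s in (0 : ℝ)..t, lam * Real.exp (lam * s) * v s := by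
  rw [lowpass, ← intervalIntegral.integral_const_mul]
  congr 1
  ext s
  rw [show -(lam * (t - s)) = -lam * t + lam * s by ring, Real.exp_add]
  ring

theorem lowpass_neg (lam : ℝ) (v : ℝ → ℝ) (t : ℝ) :
    lowpass lam (fun s => -v s) t = -lowpass lam v t := by
  simp [lowpass]

theorem lowpass_zero (lam : ℝ) (v : ℝ → ℝ) : lowpass lam v 0 = 0 := by simp [lowpass]

theorem lowpass_ode (lam : ℝ) {v : ℝ → ℝ} (hv : Signal v) :
    SolvesODE (lowpass lam v) fun t => lam * (v t - lowpass lam v t) := by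
  have h1 : Signal fun s => lam * Real.exp (lam * s) * v s :=
    Signal.mul (continuous_const.mul (continuous_exp_mul lam)).continuousOn hv
  refine (((solvesODE_exp_mul (-lam)).mul h1.ode).congr_left fun t _ =>
    (lowpass_eq lam v t).symm).congr fun t _ => ?_
  rw [lowpass_eq]
  have h2 : Real.exp (-lam * t) * Real.exp (lam * t) = 1 := by
    rw [← Real.exp_add]; simp
  linear_combination (lam * v t) * h2

theorem filter_eq {lam : ℝ} {x v : ℝ → ℝ} (hv : Signal v)
    (hx : SolvesODE x fun t => lam * (v t - x t)) {t : ℝ} (ht : 0 ≤ t) :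
    x t = Real.exp (-(lam * t)) * x 0 + lowpass lam v t := by
  have h := ((hx.sub (lowpass_ode lam hv)).congr (w := fun t => -(lam * (x t - lowpass lam v t)))
    fun s _ => by ring).eq_mul_exp continuousOn_const ht
  simp only [lowpass_zero, sub_zero, intervalIntegral.integral_const, smul_eq_mul] at h
  rw [mul_comm lam t]
  linarith

theorem filter_bdd {lam b : ℝ} (hlam : 0 ≤ lam) {x v : ℝ → ℝ} (hv : ∀ t, 0 ≤ t → |v t| ≤ b)
    (h0 : |x 0| ≤ b) (hx : SolvesODE x fun t => lam * (v t - x t)) {t : ℝ} (ht : 0 ≤ t) :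
    |x t| ≤ b := by
  refine abs_le.2 ⟨hx.ge_of_nonneg (abs_le.1 h0).1 (fun s hs h => ?_) ht,
    hx.le_of_nonpos (abs_le.1 h0).2 (fun s hs h => ?_) ht⟩
  · exact mul_nonneg hlam (by linarith [(abs_le.1 (hv s hs)).1])
  · exact mul_nonpos_of_nonneg_of_nonpos hlam (by linarith [(abs_le.1 (hv s hs)).2])

/-! ### The reactor and the linear regression -/

/-- The standing assumptions on the plant, its trajectory and the tuning constants. -/
structure Scenario (k₀ : ℝ) (g : Gains) (θ : Fin 5 → ℝ) (CA T Tin u : ℝ → ℝ) : Prop where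
  k₀_pos : 0 < k₀
  gains : g.Admissible
  θ0_pos : 0 < θ 0
  θ1_pos : 0 < θ 1
  θ2_sign : 0 < g.γb * θ 2
  θ3_pos : 0 < θ 3
  θ4_pos : 0 < θ 4
  influent : AdmissibleInfluent Tin
  input_cont : ContinuousOn u (Ici 0)
  CA_init : 0 < CA 0
  traj : IsReactorTrajectory k₀ θ CA T Tin u
  bdd : BoundedTrajectory CA T

/-- The parameter vector `(θ₁θ₃, θ₂, θ₃, θ₄, θ₂θ₃)` of the linear regression. -/
def regressionParam (θ : Fin 5 → ℝ) : Fin 5 → ℝ :=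
  ![θ 0 * θ 2, θ 1, θ 2, θ 3, θ 1 * θ 2]

namespace Scenario

variable {k₀ : ℝ} {g : Gains} {θ : Fin 5 → ℝ} {CA T Tin u : ℝ → ℝ} {t : ℝ}

theorem T_pos (S : Scenario k₀ g θ CA T Tin u) (ht : 0 ≤ t) : 0 < T t := by
  obtain ⟨a, b, ha, h⟩ := S.bdd
  exact ha.trans_le (h t ht).2.1

theorem CA_lower (S : Scenario k₀ g θ CA T Tin u) :
    ∃ c, 0 < c ∧ ∀ t, 0 ≤ t → c ≤ CA t := by
  have hd : 0 < θ 1 + k₀ := add_pos S.θ1_pos S.k₀_pos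
  refine ⟨min (CA 0) (θ 0 / (θ 1 + k₀)), lt_min S.CA_init (div_pos S.θ0_pos hd), fun t ht => ?_⟩
  refine S.traj.1.ge_of_nonneg (min_le_left _ _) (fun s hs h => ?_) ht
  have h1 : CA s < θ 0 / (θ 1 + k₀) := h.trans_le (min_le_right _ _)
  have h2 : CA s * (θ 1 + k₀) < θ 0 := (lt_div_iff₀ hd).1 h1
  have h3 : Real.exp (-(θ 4 / T s)) ≤ 1 := by
    rw [Real.exp_le_one_iff, neg_nonpos]
    exact (div_pos S.θ4_pos (S.T_pos hs)).le
  have h4 := Real.exp_pos (-(θ 4 / T s))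
  have hθ := S.θ0_pos
  have h5 : k₀ * Real.exp (-(θ 4 / T s)) ≤ k₀ := mul_le_of_le_one_right S.k₀_pos.le h3
  have h6 : 0 < k₀ * Real.exp (-(θ 4 / T s)) := mul_pos S.k₀_pos h4
  have h7 := S.θ1_pos
  rcases le_total (CA s) 0 with hc | hc
  · nlinarith
  · nlinarith

theorem signal_T_sub (S : Scenario k₀ g θ CA T Tin u) : Signal fun s => T s - Tin s :=
  (Signal.of_continuousOn S.traj.2.1).sub (Signal.of_admissible S.influent)

end Scenario

/-- The measured signals that drive the six filters. -/
def filterInput (CA T Tin u : ℝ → ℝ) (t : ℝ) : Fin 6 → ℝ :=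
  ![1, T t - Tin t, CA t, u t, CA t, T t]

/-- The filtered plant equations: `y = φ ⬝ᵥ μ`. The defect solves `ḋ = -λ d`, `d(0) = 0`. -/
theorem filtered_regression {k₀ : ℝ} {g : Gains} {θ : Fin 5 → ℝ} {CA T Tin u : ℝ → ℝ} {t : ℝ}
    (S : Scenario k₀ g θ CA T Tin u) {X : Fin 6 → ℝ → ℝ}
    (hX0 : ∀ i, X i 0 = (![0, 0, CA 0, 0, 0, T 0] : Fin 6 → ℝ) i)
    (hX : ∀ i, SolvesODE (X i) fun t => g.lam * (filterInput CA T Tin u t i - X i t))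
    (ht : 0 ≤ t) :
    -(g.lam * (T t - X 5 t)) = ![X 0 t, X 1 t, -(g.lam * (CA t - X 2 t)), -X 3 t, -X 4 t]
      ⬝ᵥ regressionParam θ := by
  have h1 := ((S.traj.2.sub (hX 5)).const_mul (-g.lam)).sub
    (((((hX 0).const_mul (θ 0 * θ 2)).add ((hX 1).const_mul (θ 1))).sub
      (((S.traj.1.sub (hX 2)).const_mul g.lam).const_mul (θ 2))).sub
      (((hX 3).const_mul (θ 3)).add ((hX 4).const_mul (θ 1 * θ 2))))
  have h2 := (h1.congr (w := fun t => -(g.lam * (-g.lam * (T t - X 5 t)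
    - (θ 0 * θ 2 * X 0 t + θ 1 * X 1 t - θ 2 * (g.lam * (CA t - X 2 t))
      - (θ 3 * X 3 t + θ 1 * θ 2 * X 4 t))))) fun s _ => by
    simp [filterInput]; ring).eq_mul_exp continuousOn_const ht
  simp only [hX0] at h2
  simp [regressionParam, dotProduct, Fin.sum_univ_five] at h2 ⊢
  linarith

/-- The right-hand side of the estimator evaluated along a run. -/
theorem IsEstimatorRun.ode {k₀ : ℝ} {g : Gains} {CA T Tin u : ℝ → ℝ} {χ0 : Chi} {χ : ℝ → Chi}
    (R : IsEstimatorRun k₀ g CA T Tin u χ0 χ) (i : ChiIdx) :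
    SolvesODE (fun t => χ t i) fun t => vectorField k₀ g (χ t) (CA t) (T t) (Tin t) (u t) i :=
  R.2.apply i

namespace Run

variable {k₀ : ℝ} {g : Gains} {θ : Fin 5 → ℝ} {CA T Tin u : ℝ → ℝ} {eta0 : Fin 4 → ℝ}
  {rho0 : ℝ} {χ : ℝ → Chi} {t : ℝ}

theorem filt_ode (R : IsEstimatorRun k₀ g CA T Tin u (initialState g eta0 rho0 (CA 0) (T 0)) χ)
    (i : Fin 6) : SolvesODE (fun t => filt (χ t) i)
      fun t => g.lam * (filterInput CA T Tin u t i - filt (χ t) i) :=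
  R.ode (.inl i)

theorem filt_init (R : IsEstimatorRun k₀ g CA T Tin u (initialState g eta0 rho0 (CA 0) (T 0)) χ)
    (i : Fin 6) : filt (χ 0) i = (![0, 0, CA 0, 0, 0, T 0] : Fin 6 → ℝ) i := by
  rw [R.1]; rfl

theorem phi_cont (S : Scenario k₀ g θ CA T Tin u)
    (R : IsEstimatorRun k₀ g CA T Tin u (initialState g eta0 rho0 (CA 0) (T 0)) χ) :
    ContinuousOn (fun t => phiSig g (χ t) (CA t)) (Ici 0) := by
  refine continuousOn_pi.2 fun i => ?_
  have h := fun i => (filt_ode R i).1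
  have hC := S.traj.1.1
  fin_cases i
  · exact h 0
  · exact h 1
  · exact (continuousOn_const.mul (hC.sub (h 2))).neg
  · exact (h 3).neg
  · exact (h 4).neg

theorem ySig_eq (S : Scenario k₀ g θ CA T Tin u)
    (R : IsEstimatorRun k₀ g CA T Tin u (initialState g eta0 rho0 (CA 0) (T 0)) χ) (ht : 0 ≤ t) :
    ySig g (χ t) (T t) = phiSig g (χ t) (CA t) ⬝ᵥ regressionParam θ :=
  filtered_regression S (filt_init R) (filt_ode R) ht

theorem leastSquares (S : Scenario k₀ g θ CA T Tin u)
    (R : IsEstimatorRun k₀ g CA T Tin u (initialState g eta0 rho0 (CA 0) (T 0)) χ) :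
    LeastSquares g (regressionParam θ) (fun t => phiSig g (χ t) (CA t)) (fun t => Fmat (χ t))
      (fun t => zState (χ t)) (fun t => muHat (χ t)) where
  cont := phi_cont S R
  F_init := by rw [R.1]; rfl
  z_init := by rw [R.1]; rfl
  mu_init := by rw [R.1]; rfl
  F_ode := SolvesODE.of_entry fun i j => R.ode (.inr (.inr (.inl (i, j))))
  z_ode := R.ode (.inr (.inr (.inr (.inr (.inl 0)))))
  mu_ode := SolvesODE.pi fun i => (R.ode (.inr (.inl i))).congr fun s hs => by
    rw [← ySig_eq S R hs]; rfl

theorem phiSig_eq_regressor (S : Scenario k₀ g θ CA T Tin u)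
    (R : IsEstimatorRun k₀ g CA T Tin u (initialState g eta0 rho0 (CA 0) (T 0)) χ) (ht : 0 ≤ t) :
    phiSig g (χ t) (CA t) = regressor g.lam CA T Tin u t := by
  have hC : Signal CA := Signal.of_continuousOn S.traj.1.1
  have h0 := filter_eq (v := fun _ => 1) (Signal.of_continuousOn continuousOn_const) (filt_ode R 0) ht
  have h1 := filter_eq S.signal_T_sub (filt_ode R 1) ht
  have h2 := filter_eq hC (filt_ode R 2) ht
  have h3 := filter_eq (Signal.of_continuousOn S.input_cont) (filt_ode R 3) ht
  have h4 := filter_eq hC (filt_ode R 4) ht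
  simp only [filt_init R] at h0 h1 h2 h3 h4
  simp at h0 h1 h2 h3 h4
  ext i
  fin_cases i
  · simpa [phiSig, regressor] using h0
  · simpa [phiSig, regressor] using h1
  · simp only [phiSig, regressor, dirty, lowpass_neg]
    simp [h2]
    ring
  · simpa [phiSig, regressor, lowpass_neg] using h3
  · simpa [phiSig, regressor, lowpass_neg] using h4

/-- All filter states are bounded. The input `u` need not be bounded, but its filtered version is,
by the regression equation. -/
theorem filt_bdd (S : Scenario k₀ g θ CA T Tin u)
    (R : IsEstimatorRun k₀ g CA T Tin u (initialState g eta0 rho0 (CA 0) (T 0)) χ) :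
    ∃ b, ∀ t, 0 ≤ t → ∀ i, |filt (χ t) i| ≤ b := by
  obtain ⟨a, b, ha, hb⟩ := S.bdd
  obtain ⟨d, hd⟩ := S.influent.2.1
  have hl : 0 < g.lam := S.gains.1
  have hCA : ∀ t, 0 ≤ t → |CA t| ≤ b := fun t ht => (hb t ht).1
  have hT : ∀ t, 0 ≤ t → |T t| ≤ b := fun t ht =>
    abs_le.2 ⟨by linarith [(hb t ht).2.1, (hb t ht).2.2], (hb t ht).2.2⟩
  have hb0 : 0 ≤ b := (abs_nonneg _).trans (hCA 0 le_rfl)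
  have hd0 : 0 ≤ d := (abs_nonneg _).trans (hd 0 le_rfl)
  have h0 : ∀ t, 0 ≤ t → |filt (χ t) 0| ≤ 1 := fun t ht =>
    filter_bdd hl.le (fun _ _ => by simp [filterInput]) (by simp [filt_init R]) (filt_ode R 0) ht
  have h1 : ∀ t, 0 ≤ t → |filt (χ t) 1| ≤ b + d := fun t ht =>
    filter_bdd hl.le (fun s hs => (abs_sub _ _).trans (add_le_add (hT s hs) (hd s hs)))
      (by simp [filt_init R]; positivity) (filt_ode R 1) ht
  have h2 : ∀ t, 0 ≤ t → |filt (χ t) 2| ≤ b := fun t ht =>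
    filter_bdd hl.le (fun s hs => hCA s hs)
      (by simpa [filt_init R] using hCA 0 le_rfl) (filt_ode R 2) ht
  have h4 : ∀ t, 0 ≤ t → |filt (χ t) 4| ≤ b := fun t ht =>
    filter_bdd hl.le (fun s hs => hCA s hs)
      (by simpa [filt_init R] using hb0) (filt_ode R 4) ht
  have h5 : ∀ t, 0 ≤ t → |filt (χ t) 5| ≤ b := fun t ht =>
    filter_bdd hl.le (fun s hs => hT s hs)
      (by simpa [filt_init R] using hT 0 le_rfl) (filt_ode R 5) ht
  have h3 : ∀ t, 0 ≤ t → |filt (χ t) 3| ≤ (g.lam * (b + b) + |θ 0 * θ 2| + |θ 1| * (b + d)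
      + |θ 2| * (g.lam * (b + b)) + |θ 1 * θ 2| * b) / θ 3 := by
    intro t ht
    have h := ySig_eq S R ht
    simp [phiSig, ySig, regressionParam, dotProduct, Fin.sum_univ_five] at h
    rw [le_div_iff₀ S.θ3_pos, ← abs_of_pos S.θ3_pos, ← abs_mul]
    have e : filt (χ t) 3 * θ 3 = g.lam * (T t - filt (χ t) 5) + (θ 0 * θ 2) * filt (χ t) 0
        + θ 1 * filt (χ t) 1 - θ 2 * (g.lam * (CA t - filt (χ t) 2))
        - (θ 1 * θ 2) * filt (χ t) 4 := by linarith
    rw [e]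
    have e1 : |g.lam * (T t - filt (χ t) 5)| ≤ g.lam * (b + b) := by
      rw [abs_mul, abs_of_pos hl]
      exact mul_le_mul_of_nonneg_left ((abs_sub _ _).trans (add_le_add (hT t ht) (h5 t ht))) hl.le
    have e2 : |g.lam * (CA t - filt (χ t) 2)| ≤ g.lam * (b + b) := by
      rw [abs_mul, abs_of_pos hl]
      exact mul_le_mul_of_nonneg_left ((abs_sub _ _).trans (add_le_add (hCA t ht) (h2 t ht))) hl.le
    refine (abs_sub _ _).trans (add_le_add ((abs_sub _ _).trans (add_le_add
      ((abs_add_le _ _).trans (add_le_add ((abs_add_le _ _).trans (add_le_add e1 ?_)) ?_)) ?_)) ?_)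
    · rw [abs_mul]; exact mul_le_of_le_one_right (abs_nonneg _) (h0 t ht)
    · rw [abs_mul]; exact mul_le_mul_of_nonneg_left (h1 t ht) (abs_nonneg _)
    · rw [abs_mul]; exact mul_le_mul_of_nonneg_left e2 (abs_nonneg _)
    · rw [abs_mul]; exact mul_le_mul_of_nonneg_left (h4 t ht) (abs_nonneg _)
  set B := (g.lam * (b + b) + |θ 0 * θ 2| + |θ 1| * (b + d)
      + |θ 2| * (g.lam * (b + b)) + |θ 1 * θ 2| * b) / θ 3
  have hB : 0 ≤ B := (abs_nonneg _).trans (h3 0 le_rfl)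
  refine ⟨1 + b + d + B, fun t ht i => ?_⟩
  fin_cases i
  · exact (h0 t ht).trans (by linarith)
  · exact (h1 t ht).trans (by linarith)
  · exact (h2 t ht).trans (by linarith)
  · exact (h3 t ht).trans (by linarith)
  · exact (h4 t ht).trans (by linarith)
  · exact (h5 t ht).trans (by linarith)

end Run

/-! ### Exponential decay -/

/-- The signal `f` decays exponentially on `[0, ∞)`. -/
def ExpDecay (f : ℝ → ℝ) : Prop :=
  ∃ C κ : ℝ, 0 < κ ∧ ∀ t, 0 ≤ t → |f t| ≤ C * Real.exp (-(κ * t))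

namespace ExpDecay

theorem of_le {f h : ℝ → ℝ} (hf : ExpDecay f) (K : ℝ) (hK : ∀ t, 0 ≤ t → |h t| ≤ K * |f t|) :
    ExpDecay h := by
  obtain ⟨C, κ, hκ, hC⟩ := hf
  refine ⟨|K| * C, κ, hκ, fun t ht => (hK t ht).trans ?_⟩
  calc K * |f t| ≤ |K| * |f t| := mul_le_mul_of_nonneg_right (le_abs_self K) (abs_nonneg _)
    _ ≤ |K| * (C * Real.exp (-(κ * t))) := mul_le_mul_of_nonneg_left (hC t ht) (abs_nonneg K)
    _ = |K| * C * Real.exp (-(κ * t)) := by ring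

theorem add {f h : ℝ → ℝ} (hf : ExpDecay f) (hh : ExpDecay h) : ExpDecay fun t => f t + h t := by
  obtain ⟨C, κ, hκ, hC⟩ := hf
  obtain ⟨D, l, hl, hD⟩ := hh
  have hC0 : 0 ≤ C := by simpa using (abs_nonneg _).trans (hC 0 le_rfl)
  have hD0 : 0 ≤ D := by simpa using (abs_nonneg _).trans (hD 0 le_rfl)
  refine ⟨C + D, min κ l, lt_min hκ hl, fun t ht => (abs_add_le _ _).trans ?_⟩
  rw [add_mul]
  refine add_le_add ((hC t ht).trans (mul_le_mul_of_nonneg_left (Real.exp_le_exp.2 ?_) hC0))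
    ((hD t ht).trans (mul_le_mul_of_nonneg_left (Real.exp_le_exp.2 ?_) hD0))
  · exact neg_le_neg (mul_le_mul_of_nonneg_right (min_le_left _ _) ht)
  · exact neg_le_neg (mul_le_mul_of_nonneg_right (min_le_right _ _) ht)

theorem sum {ι : Type*} (s : Finset ι) {f : ι → ℝ → ℝ} (hf : ∀ i ∈ s, ExpDecay (f i)) :
    ExpDecay fun t => ∑ i ∈ s, f i t := by
  classical
  induction s using Finset.induction_on with
  | empty => exact ⟨0, 1, one_pos, fun t _ => by simp⟩
  | insert a s ha ih =>
    simp only [Finset.sum_insert ha]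
    exact (hf a (Finset.mem_insert_self a s)).add
      (ih fun i hi => hf i (Finset.mem_insert_of_mem hi))

theorem abs {f : ℝ → ℝ} (hf : ExpDecay f) : ExpDecay fun t => |f t| :=
  hf.of_le 1 fun t _ => by simp

theorem bdd {f : ℝ → ℝ} (hf : ExpDecay f) : ∃ b, ∀ t, 0 ≤ t → |f t| ≤ b := by
  obtain ⟨C, κ, hκ, hC⟩ := hf
  have hC0 : 0 ≤ C := by simpa using (abs_nonneg _).trans (hC 0 le_rfl)
  refine ⟨C, fun t ht => (hC t ht).trans (mul_le_of_le_one_right hC0 ?_)⟩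
  rw [Real.exp_le_one_iff, neg_nonpos]
  positivity

end ExpDecay

/-- One-sided decay of a solution of `ẋ ≤ -m x + C exp (-κ t)`. -/
theorem SolvesODE.le_exp {x v : ℝ → ℝ} {m C κ : ℝ} (hm : 0 < m) (hx : SolvesODE x v)
    (h : ∀ t, 0 ≤ t → 0 < x t → v t ≤ -(m * x t) + C * Real.exp (-(κ * t))) (hC : 0 ≤ C)
    {t : ℝ} (ht : 0 ≤ t) :
    x t ≤ (|x 0| + 2 * C / m) * Real.exp (-(min κ (m / 2) * t)) := by
  set l := min κ (m / 2) with hl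
  have hl1 : l ≤ κ := min_le_left _ _
  have hl2 : l ≤ m / 2 := min_le_right _ _
  -- the rescaled signal `x exp (l t)` cannot grow above the constant `|x 0| + 2 C / m`
  have h1 := (hx.mul (solvesODE_exp_mul l)).le_of_nonpos (B := |x 0| + 2 * C / m) ?_
    (fun s hs hB => ?_) ht
  · have h2 : Real.exp (l * t) * Real.exp (-(l * t)) = 1 := by rw [← Real.exp_add]; simp
    calc x t = x t * Real.exp (l * t) * Real.exp (-(l * t)) := by rw [mul_assoc, h2, mul_one]
      _ ≤ _ := mul_le_mul_of_nonneg_right h1 (Real.exp_pos _).le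
  · have : 0 ≤ 2 * C / m := by positivity
    simpa using (le_abs_self (x 0)).trans (le_add_of_nonneg_right this)
  · have he := Real.exp_pos (l * s)
    have hB1 : 2 * C / m < x s * Real.exp (l * s) := by linarith [abs_nonneg (x 0)]
    have hxs : 0 < x s := by
      have : 0 < x s * Real.exp (l * s) := lt_of_le_of_lt (by positivity) hB1
      exact pos_of_mul_pos_left this he.le
    rw [div_lt_iff₀ hm] at hB1
    have hv := mul_le_mul_of_nonneg_right (h s hs hxs) he.le
    have h3 : Real.exp (-(κ * s)) * Real.exp (l * s) ≤ 1 := by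
      rw [← Real.exp_add, Real.exp_le_one_iff]
      nlinarith
    have h4 := mul_le_mul_of_nonneg_left h3 hC
    have h5 := mul_le_mul_of_nonneg_right hl2 (mul_pos hxs he).le
    nlinarith

theorem SolvesODE.expDecay {x v : ℝ → ℝ} {m C κ : ℝ} (hm : 0 < m) (hκ : 0 < κ)
    (hx : SolvesODE x v)
    (h : ∀ t, 0 ≤ t → 0 < x t → v t ≤ -(m * x t) + C * Real.exp (-(κ * t)))
    (h' : ∀ t, 0 ≤ t → x t < 0 → -(m * x t) - C * Real.exp (-(κ * t)) ≤ v t) (hC : 0 ≤ C) :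
    ExpDecay x := by
  refine ⟨|x 0| + 2 * C / m, min κ (m / 2), lt_min hκ (half_pos hm), fun t ht =>
    abs_le'.2 ⟨hx.le_exp hm h hC ht, ?_⟩⟩
  have := hx.neg.le_exp hm (C := C) (κ := κ) (fun s hs hlt => ?_) hC ht
  · simpa using this
  · have := h' s hs (by simpa using hlt)
    linarith

/-- Convergence of the error of the exponent estimate. The scalar dynamics
`ẋ = G (p exp (-(x - s) / T) - q) + r` have the equilibrium `0` in the limit `p → q`, `s → 0`,
`r → 0`. The exponential saturates for `x → ∞`, so boundedness is proved first, and the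
exponential rate then follows by linearization. -/
theorem expDecay_of_exponential_feedback {x v G p s r T : ℝ → ℝ} {q g₁ g₂ p₁ a b C κ : ℝ}
    (hx : SolvesODE x v) (hg₁ : 0 < g₁) (hp₁ : 0 < p₁) (hq : 0 < q) (ha : 0 < a) (hκ : 0 < κ)
    (hv : ∀ t, 0 ≤ t → v t = G t * (p t * Real.exp (-((x t - s t) / T t)) - q) + r t)
    (hG : ∀ t, 0 ≤ t → g₁ ≤ G t ∧ G t ≤ g₂) (hp : ∀ t, 0 ≤ t → p₁ ≤ p t)
    (hT : ∀ t, 0 ≤ t → a ≤ T t ∧ T t ≤ b)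
    (hpq : ∀ t, 0 ≤ t → |p t - q| ≤ C * Real.exp (-(κ * t)))
    (hs : ∀ t, 0 ≤ t → |s t| ≤ C * Real.exp (-(κ * t)))
    (hr : ∀ t, 0 ≤ t → |r t| ≤ C * Real.exp (-(κ * t))) : ExpDecay x := by
  have hC : 0 ≤ C := by simpa using (abs_nonneg _).trans (hr 0 le_rfl)
  have hb : 0 < b := ha.trans_le ((hT 0 le_rfl).1.trans (hT 0 le_rfl).2)
  have hg₂ : 0 < g₂ := hg₁.trans_le ((hG 0 le_rfl).1.trans (hG 0 le_rfl).2)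
  have hdec : ∀ t, 0 ≤ t → C * Real.exp (-(κ * t)) ≤ C := fun t ht =>
    mul_le_of_le_one_right hC (by rw [Real.exp_le_one_iff, neg_nonpos]; positivity)
  have hT0 : ∀ t, 0 ≤ t → 0 < T t := fun t ht => ha.trans_le (hT t ht).1
  -- far to the left the exponential dominates and pushes `x` back
  have hlow : ∃ K, ∀ t, 0 ≤ t → -K ≤ x t := by
    set Y := b * ((q + C / g₁) / p₁) with hY
    have hY0 : 0 ≤ Y := by positivity
    refine ⟨|x 0| + C + Y, fun t ht => hx.ge_of_nonneg (by linarith [neg_abs_le (x 0)])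
      (fun t ht hlt => ?_) ht⟩
    have h1 : Y ≤ -(x t - s t) := by
      linarith [(abs_le.1 (hs t ht)).1, hdec t ht, abs_nonneg (x 0)]
    have h2 : (q + C / g₁) / p₁ ≤ -((x t - s t) / T t) := by
      rw [← neg_div, le_div_iff₀ (hT0 t ht)]
      calc (q + C / g₁) / p₁ * T t ≤ (q + C / g₁) / p₁ * b :=
            mul_le_mul_of_nonneg_left (hT t ht).2 (by positivity)
        _ = Y := by rw [hY]; ring
        _ ≤ _ := h1
    have h3 : (q + C / g₁) / p₁ ≤ Real.exp (-((x t - s t) / T t)) :=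
      h2.trans (by linarith [Real.add_one_le_exp (-((x t - s t) / T t))])
    have h4 : q + C / g₁ ≤ p t * Real.exp (-((x t - s t) / T t)) :=
      calc q + C / g₁ = p₁ * ((q + C / g₁) / p₁) := by field_simp
        _ ≤ _ := mul_le_mul (hp t ht) h3 (by positivity) (hp₁.le.trans (hp t ht))
    have h5 : C ≤ G t * (p t * Real.exp (-((x t - s t) / T t)) - q) :=
      calc C = g₁ * (C / g₁) := by field_simp
        _ ≤ _ := mul_le_mul (hG t ht).1 (by linarith) (by positivity)
            (hg₁.le.trans (hG t ht).1)
    rw [hv t ht]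
    linarith [(abs_le.1 (hr t ht)).1, hdec t ht]
  -- far to the right the feedback is negative; the shift absorbs the integrable perturbation `r`
  have hup : ∃ K, ∀ t, 0 ≤ t → x t ≤ K := by
    have h0 := hx.add ((solvesODE_exp_mul (-κ)).const_mul (C / κ))
    have hCκ : 0 ≤ C / κ := by positivity
    have hbq : 0 ≤ b * (C / q) := by positivity
    refine ⟨|x 0| + C / κ + C + b * (C / q), fun t ht => ?_⟩
    have h1 := h0.le_of_nonpos (B := |x 0| + C / κ + C + b * (C / q)) ?_ (fun t ht hlt => ?_) ht
    · have : 0 ≤ C / κ * Real.exp (-κ * t) := by positivity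
      linarith
    · simp only [mul_zero, Real.exp_zero, mul_one]
      linarith [le_abs_self (x 0)]
    · have e1 : C / κ * (-κ * Real.exp (-κ * t)) = -(C * Real.exp (-(κ * t))) := by
        rw [neg_mul]; field_simp
      have e2 : C / κ * Real.exp (-κ * t) ≤ C / κ :=
        mul_le_of_le_one_right hCκ (by rw [Real.exp_le_one_iff]; nlinarith)
      have h2 : b * (C / q) ≤ x t - s t := by
        linarith [(abs_le.1 (hs t ht)).2, hdec t ht, abs_nonneg (x 0)]
      have h3 : C / q ≤ (x t - s t) / T t := by
        rw [le_div_iff₀ (hT0 t ht)]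
        calc C / q * T t ≤ C / q * b :=
              mul_le_mul_of_nonneg_left (hT t ht).2 (by positivity)
          _ = b * (C / q) := by ring
          _ ≤ _ := h2
      have h4 : p t * Real.exp (-((x t - s t) / T t)) ≤ q := by
        have h5 : p t ≤ q * Real.exp ((x t - s t) / T t) :=
          calc p t ≤ q + C := by linarith [(abs_le.1 (hpq t ht)).2, hdec t ht]
            _ = q * (C / q + 1) := by rw [mul_add, mul_div_cancel₀ _ hq.ne']; ring
            _ ≤ _ := mul_le_mul_of_nonneg_left
                ((add_le_add_left h3 1).trans (Real.add_one_le_exp _)) hq.le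
        calc _ ≤ q * Real.exp ((x t - s t) / T t) * Real.exp (-((x t - s t) / T t)) :=
              mul_le_mul_of_nonneg_right h5 (Real.exp_pos _).le
          _ = q := by rw [mul_assoc, ← Real.exp_add]; simp
      have h6 : G t * (p t * Real.exp (-((x t - s t) / T t)) - q) ≤ 0 :=
        mul_nonpos_of_nonneg_of_nonpos (hg₁.le.trans (hG t ht).1) (by linarith)
      rw [hv t ht, e1]
      linarith [(abs_le.1 (hr t ht)).2]
  obtain ⟨K₁, hK₁⟩ := hlow
  obtain ⟨K₂, hK₂⟩ := hup
  set X := max K₁ K₂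
  have hX : ∀ t, 0 ≤ t → |x t| ≤ X := fun t ht =>
    abs_le.2 ⟨by linarith [hK₁ t ht, le_max_left K₁ K₂], (hK₂ t ht).trans (le_max_right _ _)⟩
  have hX0 : 0 ≤ X := (abs_nonneg _).trans (hX 0 le_rfl)
  -- the perturbation of the feedback by `p - q` and `s` decays exponentially
  set D := C * Real.exp ((X + C) / a) + q * (Real.exp (X / a) * (C / a * Real.exp (C / a)))
  have hD : ∀ t, 0 ≤ t → |p t * Real.exp (-((x t - s t) / T t)) - q * Real.exp (-(x t / T t))|
      ≤ D * Real.exp (-(κ * t)) := by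
    intro t ht
    have hTt := hT0 t ht
    have hdiv : ∀ {y Z : ℝ}, |y| ≤ Z → |y / T t| ≤ Z / a := fun {y Z} h => by
      rw [abs_div, abs_of_pos hTt]
      exact div_le_div₀ ((abs_nonneg y).trans h) h ha (hT t ht).1
    have hsC : |s t| ≤ C := (hs t ht).trans (hdec t ht)
    have e1 : Real.exp (-((x t - s t) / T t)) ≤ Real.exp ((X + C) / a) :=
      Real.exp_le_exp.2 ((neg_le_abs _).trans
        (hdiv ((abs_sub _ _).trans (add_le_add (hX t ht) hsC))))
    have e2 : Real.exp (-(x t / T t)) ≤ Real.exp (X / a) :=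
      Real.exp_le_exp.2 ((neg_le_abs _).trans (hdiv (hX t ht)))
    have e3 : |Real.exp (s t / T t) - 1| ≤ C / a * Real.exp (C / a) * Real.exp (-(κ * t)) := by
      have f1 : |s t / T t| ≤ C / a := hdiv hsC
      have f2 : |s t / T t| ≤ C / a * Real.exp (-(κ * t)) := by
        rw [div_mul_eq_mul_div]; exact hdiv (hs t ht)
      have f3 : |Real.exp (s t / T t) - 1| ≤ |s t / T t| * Real.exp |s t / T t| := by
        set y := s t / T t
        have k1 := Real.add_one_le_exp y
        have k2 := Real.add_one_le_exp (-y)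
        have k3 : Real.exp y * Real.exp (-y) = 1 := by rw [← Real.exp_add]; simp
        rcases le_total 0 y with hy | hy
        · rw [abs_of_nonneg hy, abs_of_nonneg (by linarith)]
          nlinarith [Real.exp_pos y]
        · rw [abs_of_nonpos hy, abs_of_nonpos (by linarith [Real.exp_le_one_iff.2 hy])]
          nlinarith [Real.exp_pos (-y), Real.one_le_exp (neg_nonneg.2 hy)]
      calc _ ≤ |s t / T t| * Real.exp |s t / T t| := f3
        _ ≤ C / a * Real.exp (-(κ * t)) * Real.exp (C / a) :=
          mul_le_mul f2 (Real.exp_le_exp.2 f1) (Real.exp_pos _).le (by positivity)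
        _ = _ := by ring
    have e4 : p t * Real.exp (-((x t - s t) / T t)) - q * Real.exp (-(x t / T t))
        = (p t - q) * Real.exp (-((x t - s t) / T t))
          + q * (Real.exp (-(x t / T t)) * (Real.exp (s t / T t) - 1)) := by
      have : Real.exp (-((x t - s t) / T t))
          = Real.exp (-(x t / T t)) * Real.exp (s t / T t) := by
        rw [← Real.exp_add]; congr 1; ring
      rw [this]; ring
    rw [e4]
    refine (abs_add_le _ _).trans ?_
    rw [abs_mul, abs_mul, abs_mul, Real.abs_exp, Real.abs_exp, abs_of_pos hq]
    calc _ ≤ C * Real.exp (-(κ * t)) * Real.exp ((X + C) / a)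
          + q * (Real.exp (X / a) * (C / a * Real.exp (C / a) * Real.exp (-(κ * t)))) := by
          refine add_le_add (mul_le_mul (hpq t ht) e1 (Real.exp_pos _).le (by positivity))
            (mul_le_mul_of_nonneg_left (mul_le_mul e2 e3 (abs_nonneg _) (Real.exp_pos _).le) hq.le)
      _ = _ := by ring
  have hD0 : 0 ≤ D := by positivity
  set m := Real.exp (-(X / a)) / b
  have hm : 0 < m := by positivity
  have hm1 : m ≤ 1 / b := div_le_div_of_nonneg_right
    (by rw [Real.exp_le_one_iff, neg_nonpos]; positivity) hb.le
  have hGD : ∀ t, 0 ≤ t →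
      |G t * (p t * Real.exp (-((x t - s t) / T t)) - q * Real.exp (-(x t / T t))) + r t|
      ≤ (g₂ * D + C) * Real.exp (-(κ * t)) := fun t ht => by
    refine (abs_add_le _ _).trans ?_
    rw [add_mul, abs_mul, abs_of_pos (hg₁.trans_le (hG t ht).1), mul_assoc]
    exact add_le_add (mul_le_mul (hG t ht).2 (hD t ht) (abs_nonneg _) hg₂.le) (hr t ht)
  have hsplit : ∀ t, 0 ≤ t → v t = G t * (q * (Real.exp (-(x t / T t)) - 1))
      + (G t * (p t * Real.exp (-((x t - s t) / T t)) - q * Real.exp (-(x t / T t))) + r t) :=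
    fun t ht => by rw [hv t ht]; ring
  refine hx.expDecay (m := g₁ * (q * m)) (C := g₂ * D + C) (by positivity) hκ
    (fun t ht hpos => ?_) (fun t ht hneg => ?_) (by positivity)
  · have hTt := hT0 t ht
    have h1 : m * x t ≤ 1 - Real.exp (-(x t / T t)) := by
      have k1 := Real.add_one_le_exp (x t / T t)
      have k2 : Real.exp (x t / T t) * Real.exp (-(x t / T t)) = 1 := by
        rw [← Real.exp_add]; simp
      have k3 : x t / T t * Real.exp (-(x t / T t)) ≤ 1 - Real.exp (-(x t / T t)) := by
        nlinarith [Real.exp_pos (-(x t / T t))]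
      refine le_trans ?_ k3
      have k4 : x t / T t ≤ X / a :=
        div_le_div₀ hX0 ((le_abs_self _).trans (hX t ht)) ha (hT t ht).1
      calc m * x t = x t / b * Real.exp (-(X / a)) := by ring
        _ ≤ _ := mul_le_mul (div_le_div_of_nonneg_left hpos.le hTt (hT t ht).2)
            (Real.exp_le_exp.2 (neg_le_neg k4)) (Real.exp_pos _).le (by positivity)
    have h2 : g₁ * (q * (m * x t)) ≤ G t * (q * (1 - Real.exp (-(x t / T t)))) :=
      mul_le_mul (hG t ht).1 (mul_le_mul_of_nonneg_left h1 hq.le) (by positivity)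
        (hg₁.le.trans (hG t ht).1)
    rw [hsplit t ht]
    have h3 := (abs_le.1 (hGD t ht)).2
    linarith
  · have hTt := hT0 t ht
    have h1 : m * -x t ≤ Real.exp (-(x t / T t)) - 1 := by
      have k1 := Real.add_one_le_exp (-(x t / T t))
      have k2 : -x t / b ≤ -x t / T t :=
        div_le_div_of_nonneg_left (by linarith) hTt (hT t ht).2
      calc m * -x t ≤ 1 / b * -x t := mul_le_mul_of_nonneg_right hm1 (by linarith)
        _ = -x t / b := by ring
        _ ≤ -x t / T t := k2
        _ = -(x t / T t) := by ring
        _ ≤ _ := by linarith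
    have h2 : g₁ * (q * (m * -x t)) ≤ G t * (q * (Real.exp (-(x t / T t)) - 1)) :=
      mul_le_mul (hG t ht).1 (mul_le_mul_of_nonneg_left h1 hq.le)
        (mul_nonneg hq.le (mul_nonneg hm.le (by linarith))) (hg₁.le.trans (hG t ht).1)
    rw [hsplit t ht]
    have h3 := (abs_le.1 (hGD t ht)).1
    linarith

/-! ### Convergence of the estimates -/

theorem continuous_Delta (g : Gains) : Continuous (Delta g) := by
  refine Continuous.matrix_det ?_
  exact continuous_matrix fun i j =>
    continuous_const.sub (((continuous_apply _).mul continuous_const).mul (continuous_apply _))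

namespace Run

variable {k₀ : ℝ} {g : Gains} {θ : Fin 5 → ℝ} {CA T Tin u : ℝ → ℝ} {eta0 : Fin 4 → ℝ}
  {rho0 : ℝ} {χ : ℝ → Chi} {t : ℝ}

theorem Delta_sq_bounds (S : Scenario k₀ g θ CA T Tin u)
    (hIE : IntervalExciting (regressor g.lam CA T Tin u))
    (R : IsEstimatorRun k₀ g CA T Tin u (initialState g eta0 rho0 (CA 0) (T 0)) χ) :
    ∃ δ tc : ℝ, 0 < δ ∧ 0 < tc ∧ (∀ t, 0 ≤ t → Delta g (χ t) ^ 2 ≤ 1) ∧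
      ∀ t, tc ≤ t → δ ≤ Delta g (χ t) ^ 2 := by
  have h := leastSquares S R
  obtain ⟨c, tc, hc, htc, hpsd⟩ := hIE
  have hf := S.gains.2.2.2.1
  have hα := S.gains.2.1
  have hpsd' : (Matrix.of (fun i j : Fin 5 => ∫ s in (0 : ℝ)..tc,
      phiSig g (χ s) (CA s) i * phiSig g (χ s) (CA s) j)
      - c • (1 : Matrix (Fin 5) (Fin 5) ℝ)).PosSemidef := by
    have hW : Matrix.of (fun i j : Fin 5 => ∫ s in (0 : ℝ)..tc,
        phiSig g (χ s) (CA s) i * phiSig g (χ s) (CA s) j)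
        = Matrix.of (fun i j : Fin 5 => ∫ s in (0 : ℝ)..tc,
          regressor g.lam CA T Tin u s i * regressor g.lam CA T Tin u s j) := by
      ext i j
      refine intervalIntegral.integral_congr fun s hs => ?_
      rw [uIcc_of_le htc.le] at hs
      simp only [phiSig_eq_regressor S R hs.1]
    rwa [hW]
  have hw : 0 < g.α * c := mul_pos hα hc
  refine ⟨((g.α * c / (g.f₀ + g.α * c)) ^ 5) ^ 2, tc, by positivity, htc, fun t ht => ?_,
    fun t ht => ?_⟩
  · have h1 := h.det_mix_bounds S.gains ht le_rfl
      (fun x => by simpa using h.info_coercive S.gains ht x)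
    simp only [zero_div, ne_eq, OfNat.ofNat_ne_zero, not_false_eq_true, zero_pow] at h1
    exact pow_le_one₀ h1.1 h1.2
  · exact pow_le_pow_left₀ (by positivity) (h.det_mix_bounds S.gains (htc.le.trans ht) hw.le
      (h.info_excited S.gains htc hpsd' ht)).1 2

theorem etaHat_ode (S : Scenario k₀ g θ CA T Tin u)
    (R : IsEstimatorRun k₀ g CA T Tin u (initialState g eta0 rho0 (CA 0) (T 0)) χ) (i : Fin 4) :
    SolvesODE (fun t => etaHat (χ t) i - regressionParam θ i.castSucc) fun t =>
      -(g.γa * Delta g (χ t) ^ 2 * (etaHat (χ t) i - regressionParam θ i.castSucc)) := by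
  refine ((R.ode (.inr (.inr (.inr (.inl i))))).sub (SolvesODE.const _)).congr fun s hs => ?_
  have h := congrFun ((leastSquares S R).mixing S.gains hs) i.castSucc
  have hY : Yvec g (χ s) i.castSucc = Delta g (χ s) * regressionParam θ i.castSucc := h
  change g.γa * Delta g (χ s) * (Yvec g (χ s) i.castSucc - Delta g (χ s) * etaHat (χ s) i) - 0 = _
  rw [hY]
  ring

/-- The errors of the estimates `η̂` are all proportional to one signal `E`, which decreases from
`1` to `0` at an exponential rate. -/
theorem exists_error_factor (S : Scenario k₀ g θ CA T Tin u)
    (hIE : IntervalExciting (regressor g.lam CA T Tin u))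
    (R : IsEstimatorRun k₀ g CA T Tin u (initialState g eta0 rho0 (CA 0) (T 0)) χ) :
    ∃ (E k : ℝ → ℝ) (C κ : ℝ), 0 < κ ∧ SolvesODE E (fun t => -(k t * E t)) ∧
      (∀ t, 0 ≤ t → 0 ≤ k t ∧ k t ≤ g.γa) ∧
      (∀ t, 0 ≤ t → 0 < E t ∧ E t ≤ 1 ∧ E t ≤ C * Real.exp (-(κ * t))) ∧
      ∀ t, 0 ≤ t → ∀ i, etaHat (χ t) i = regressionParam θ i.castSucc
        + E t * (eta0 i - regressionParam θ i.castSucc) := by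
  obtain ⟨δ, tc, hδ, htc, hΔ1, hΔ2⟩ := Delta_sq_bounds S hIE R
  have hγ := S.gains.2.2.2.2.2.1
  set k : ℝ → ℝ := fun t => g.γa * Delta g (χ t) ^ 2 with hk
  have hkc : ContinuousOn k (Ici 0) :=
    continuousOn_const.mul (((continuous_Delta g).comp_continuousOn R.2.1).pow 2)
  have hI := SolvesODE.integral_of_continuousOn hkc
  have hk0 : ∀ t, 0 ≤ t → 0 ≤ k t := fun t _ => mul_nonneg hγ.le (sq_nonneg _)
  have hI0 : ∀ t, 0 ≤ t → 0 ≤ ∫ s in (0 : ℝ)..t, k s := fun t ht =>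
    hI.ge_of_nonneg (by simp) (fun s hs _ => hk0 s hs) ht
  have hI1 : ∀ t, 0 ≤ t → g.γa * δ * (t - tc) ≤ ∫ s in (0 : ℝ)..t, k s := by
    intro t ht
    rcases le_total t tc with h | h
    · exact (mul_nonpos_of_nonneg_of_nonpos (by positivity) (by linarith)).trans (hI0 t ht)
    · have hlin : SolvesODE (fun t => g.γa * δ * (t - tc)) (fun _ => g.γa * δ) :=
        SolvesODE.of_hasDerivAt fun t => by
          simpa using ((hasDerivAt_id t).sub_const tc).const_mul (g.γa * δ)
      have h1 := (hlin.sub hI).le_of_nonpos (B := 0) ?_ (fun s hs hlt => ?_) ht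
      · linarith
      · simp only [intervalIntegral.integral_same, zero_sub, sub_zero]
        have : 0 ≤ g.γa * δ * tc := by positivity
        linarith
      · -- the difference is nonpositive up to time `tc`, so that here `s > tc`
        have hs' : tc ≤ s := by
          by_contra hcon
          have := mul_nonpos_of_nonneg_of_nonpos (mul_pos hγ hδ).le
            (sub_nonpos.2 (not_le.1 hcon).le)
          linarith [hI0 s hs]
        have := mul_le_mul_of_nonneg_left (hΔ2 s hs') hγ.le
        linarith
  refine ⟨fun t => Real.exp (-∫ s in (0 : ℝ)..t, k s), k, Real.exp (g.γa * δ * tc), g.γa * δ,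
    mul_pos hγ hδ, hI.neg.exp.congr fun t _ => by ring, fun t ht => ⟨hk0 t ht, ?_⟩,
    fun t ht => ⟨Real.exp_pos _, ?_, ?_⟩, fun t ht i => ?_⟩
  · exact mul_le_of_le_one_right hγ.le (hΔ1 t ht)
  · rw [Real.exp_le_one_iff, neg_nonpos]; exact hI0 t ht
  · rw [← Real.exp_add]
    exact Real.exp_le_exp.2 (by linarith [hI1 t ht])
  · have h := (etaHat_ode S R i).eq_mul_exp hkc ht
    have h0 : etaHat (χ 0) i = eta0 i := by rw [R.1]; rfl
    rw [h0] at h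
    linarith

/-- The estimate of the activation temperature converges. The term `θ̂₄ u` of the observer contains
the unbounded input; subtracting `c E log T` with a suitable constant `c` from the error removes
it, since `θ₄ u` equals `Ṫ` up to bounded terms. -/
theorem expDecay_theta5 (S : Scenario k₀ g θ CA T Tin u)
    (hη : 0 < g.γb * eta0 2)
    (R : IsEstimatorRun k₀ g CA T Tin u (initialState g eta0 rho0 (CA 0) (T 0)) χ)
    {E k : ℝ → ℝ} {C κ : ℝ} (hκ : 0 < κ) (hE : SolvesODE E fun t => -(k t * E t))
    (hk : ∀ t, 0 ≤ t → 0 ≤ k t ∧ k t ≤ g.γa)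
    (hEb : ∀ t, 0 ≤ t → 0 < E t ∧ E t ≤ 1 ∧ E t ≤ C * Real.exp (-(κ * t)))
    (hηE : ∀ t, 0 ≤ t → ∀ i, etaHat (χ t) i = regressionParam θ i.castSucc
        + E t * (eta0 i - regressionParam θ i.castSucc)) :
    ExpDecay fun t => g.γb * Real.log (T t) + rhoI (χ t) - θ 4 := by
  obtain ⟨a, b, ha, hb⟩ := S.bdd
  obtain ⟨d, hd⟩ := S.influent.2.1
  obtain ⟨c, hc, hcCA⟩ := S.CA_lower
  have hT0 : ∀ t, 0 ≤ t → 0 < T t := fun t ht => S.T_pos ht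
  have hb0 : 0 < b := ha.trans_le ((hb 0 le_rfl).2.1.trans (hb 0 le_rfl).2.2)
  have hd0 : 0 ≤ d := (abs_nonneg _).trans (hd 0 le_rfl)
  have hγa := S.gains.2.2.2.2.2.1
  have hk₀ := S.k₀_pos
  have hθ3 := S.θ3_pos
  have h1 : ∀ t, 0 ≤ t → etaHat (χ t) 1 = θ 1 + E t * (eta0 1 - θ 1) := fun t ht => hηE t ht 1
  have h2 : ∀ t, 0 ≤ t → etaHat (χ t) 2 = θ 2 + E t * (eta0 2 - θ 2) := fun t ht => hηE t ht 2
  have h3 : ∀ t, 0 ≤ t → etaHat (χ t) 3 = θ 3 + E t * (eta0 3 - θ 3) := fun t ht => hηE t ht 3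
  have hρ := R.ode (.inr (.inr (.inr (.inr (.inr 0)))))
  have hlog := S.traj.2.log fun t ht => (hT0 t ht).ne'
  set c4 := g.γb * (eta0 3 - θ 3) / θ 3 with hc4
  have hs := (hE.mul hlog).const_mul c4
  have hx := (((hlog.const_mul g.γb).add hρ).sub (SolvesODE.const (θ 4))).add hs
  set ℓ := |Real.log a| + |Real.log b|
  have hℓ : ∀ t, 0 ≤ t → |Real.log (T t)| ≤ ℓ := fun t ht => by
    have l1 := Real.log_le_log ha (hb t ht).2.1
    have l2 := Real.log_le_log (hT0 t ht) (hb t ht).2.2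
    exact abs_le.2 ⟨by linarith [neg_abs_le (Real.log a), abs_nonneg (Real.log b)],
      by linarith [le_abs_self (Real.log b), abs_nonneg (Real.log a)]⟩
  have hℓ0 : 0 ≤ ℓ := by positivity
  have hexp : ∀ t, 0 ≤ t → Real.exp (-(θ 4 / T t)) ≤ 1 := fun t ht => by
    rw [Real.exp_le_one_iff, neg_nonpos]; exact (div_pos S.θ4_pos (hT0 t ht)).le
  set G : ℝ → ℝ := fun t => k₀ * CA t * Real.exp (-(θ 4 / T t)) / T t with hG
  set p : ℝ → ℝ := fun t => g.γb * (θ 2 + E t * (eta0 2 - θ 2)) with hp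
  set s : ℝ → ℝ := fun t => c4 * (E t * Real.log (T t)) with hsdef
  set r : ℝ → ℝ := fun t => g.γb / T t * (E t * (-(eta0 1 - θ 1) * (Tin t - T t)
      + (eta0 3 - θ 3) / θ 3 * (θ 1 * (Tin t - T t)
        - θ 2 * (k₀ * Real.exp (-(θ 4 / T t)) * CA t))))
      - c4 * (k t * E t * Real.log (T t)) with hr
  set B := |g.γb| / a * (|eta0 1 - θ 1| * (d + b) + |(eta0 3 - θ 3) / θ 3| * (|θ 1| * (d + b)
    + |θ 2| * (k₀ * b))) + |c4| * (g.γa * ℓ)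
  have hrB : ∀ t, 0 ≤ t → |r t| ≤ B * E t := by
    intro t ht
    have hEt := (hEb t ht).1
    have e1 : |Tin t - T t| ≤ d + b := (abs_sub _ _).trans
      (add_le_add (hd t ht) (by rw [abs_of_pos (hT0 t ht)]; exact (hb t ht).2.2))
    have e2 : |k₀ * Real.exp (-(θ 4 / T t)) * CA t| ≤ k₀ * b := by
      rw [abs_mul, abs_of_pos (mul_pos hk₀ (Real.exp_pos _))]
      exact mul_le_mul (mul_le_of_le_one_right hk₀.le (hexp t ht)) (hb t ht).1 (abs_nonneg _) hk₀.le
    have e3 : |g.γb / T t| ≤ |g.γb| / a := by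
      rw [abs_div, abs_of_pos (hT0 t ht)]
      exact div_le_div_of_nonneg_left (abs_nonneg _) ha (hb t ht).2.1
    have e4 : |-(eta0 1 - θ 1) * (Tin t - T t) + (eta0 3 - θ 3) / θ 3 * (θ 1 * (Tin t - T t)
        - θ 2 * (k₀ * Real.exp (-(θ 4 / T t)) * CA t))|
        ≤ |eta0 1 - θ 1| * (d + b) + |(eta0 3 - θ 3) / θ 3| * (|θ 1| * (d + b)
          + |θ 2| * (k₀ * b)) := by
      refine (abs_add_le _ _).trans (add_le_add ?_ ?_)
      · rw [abs_mul, abs_neg]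
        exact mul_le_mul_of_nonneg_left e1 (abs_nonneg _)
      · rw [abs_mul]
        refine mul_le_mul_of_nonneg_left ((abs_sub _ _).trans (add_le_add ?_ ?_)) (abs_nonneg _)
        · rw [abs_mul]; exact mul_le_mul_of_nonneg_left e1 (abs_nonneg _)
        · rw [abs_mul]; exact mul_le_mul_of_nonneg_left e2 (abs_nonneg _)
    refine (abs_sub _ _).trans ?_
    rw [add_mul]
    refine add_le_add ?_ ?_
    · rw [abs_mul, abs_mul, abs_of_pos hEt, ← mul_assoc, mul_right_comm]
      exact mul_le_mul_of_nonneg_right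
        (mul_le_mul e3 e4 (abs_nonneg _) (div_nonneg (abs_nonneg _) ha.le)) hEt.le
    · rw [abs_mul, abs_mul, abs_mul, abs_of_pos hEt, abs_of_nonneg (hk t ht).1]
      calc |c4| * (k t * E t * |Real.log (T t)|) ≤ |c4| * (g.γa * E t * ℓ) :=
            mul_le_mul_of_nonneg_left (mul_le_mul (mul_le_mul_of_nonneg_right (hk t ht).2 hEt.le)
              (hℓ t ht) (abs_nonneg _) (by positivity)) (abs_nonneg _)
        _ = |c4| * (g.γa * ℓ) * E t := by ring
  have hsB : ∀ t, 0 ≤ t → |s t| ≤ |c4| * ℓ * E t := fun t ht => by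
    have hEt := (hEb t ht).1
    rw [hsdef]
    simp only [abs_mul, abs_of_pos hEt]
    calc |c4| * (E t * |Real.log (T t)|) ≤ |c4| * (E t * ℓ) := by
          gcongr; exact hℓ t ht
      _ = _ := by ring
  have hpB : ∀ t, 0 ≤ t → |p t - g.γb * θ 2| ≤ |g.γb * (eta0 2 - θ 2)| * E t := fun t ht => by
    have hEt := (hEb t ht).1
    have e : p t - g.γb * θ 2 = g.γb * (eta0 2 - θ 2) * E t := by simp only [hp]; ring
    rw [e, abs_mul, abs_of_pos hEt]
  have hB0 : 0 ≤ B := by positivity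
  set D := (B + |c4| * ℓ + |g.γb * (eta0 2 - θ 2)|) * C
  have hED : ∀ {y : ℝ} {K : ℝ} {t : ℝ}, 0 ≤ t → |y| ≤ K * E t →
      K ≤ B + |c4| * ℓ + |g.γb * (eta0 2 - θ 2)| → |y| ≤ D * Real.exp (-(κ * t)) := by
    intro y K t ht hy hK
    have hEt := hEb t ht
    calc |y| ≤ K * E t := hy
      _ ≤ (B + |c4| * ℓ + |g.γb * (eta0 2 - θ 2)|) * E t :=
        mul_le_mul_of_nonneg_right hK hEt.1.le
      _ ≤ (B + |c4| * ℓ + |g.γb * (eta0 2 - θ 2)|) * (C * Real.exp (-(κ * t))) :=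
        mul_le_mul_of_nonneg_left hEt.2.2 (by positivity)
      _ = _ := by ring
  have hcl : 0 ≤ |c4| * ℓ := by positivity
  have hξ : ExpDecay fun t => g.γb * Real.log (T t) + rhoI (χ t) - θ 4 + s t := by
    refine expDecay_of_exponential_feedback (T := T) (s := s) (r := r) (p := p) (G := G)
      (q := g.γb * θ 2) (g₁ := k₀ * c * Real.exp (-(θ 4 / a)) / b) (g₂ := k₀ * b / a)
      (p₁ := min (g.γb * θ 2) (g.γb * eta0 2)) (a := a) (b := b) (C := D) (κ := κ) hx
      (by positivity) (lt_min S.θ2_sign hη) S.θ2_sign ha hκ (fun t ht => ?_) (fun t ht => ⟨?_, ?_⟩)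
      (fun t ht => ?_) (fun t ht => (hb t ht).2)
      (fun t ht => hED ht (hpB t ht) (by linarith))
      (fun t ht => hED ht (hsB t ht) (by linarith [abs_nonneg (g.γb * (eta0 2 - θ 2))]))
      (fun t ht => hED ht (hrB t ht) (by linarith [abs_nonneg (g.γb * (eta0 2 - θ 2))]))
    · have hTt := (hT0 t ht).ne'
      have hθh : ∀ y : ℝ, Real.exp (-((g.γb * Real.log (T t) + y - θ 4 + s t - s t) / T t))
          * Real.exp (-(θ 4 / T t)) = Real.exp (-((g.γb * Real.log (T t) + y) / T t)) := by
        intro y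
        rw [← Real.exp_add]
        congr 1
        ring
      have hvρ : vectorField k₀ g (χ t) (CA t) (T t) (Tin t) (u t)
          (.inr (.inr (.inr (.inr (.inr 0))))) = g.γb * (etaHat (χ t) 1 * (Tin t - T t)
            + etaHat (χ t) 3 * u t - etaHat (χ t) 2 * k₀ * CA t *
              Real.exp (-((g.γb * Real.log (T t) + rhoI (χ t)) / T t))) * (-(1 / T t)) := rfl
      rw [hvρ, h1 t ht, h2 t ht, h3 t ht]
      change _ = G t * (p t * Real.exp (-((g.γb * Real.log (T t) + rhoI (χ t) - θ 4 + s t - s t)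
        / T t)) - g.γb * θ 2) + r t
      rw [← hθh]
      generalize Real.exp (-((g.γb * Real.log (T t) + rhoI (χ t) - θ 4 + s t - s t) / T t)) = y
      simp only [hG, hp, hr, hc4]
      field_simp
      ring
    · exact div_le_div₀ (by have := hc.trans_le (hcCA t ht); positivity)
        (mul_le_mul (mul_le_mul_of_nonneg_left (hcCA t ht) hk₀.le)
          (Real.exp_le_exp.2 (neg_le_neg
            (div_le_div_of_nonneg_left S.θ4_pos.le ha (hb t ht).2.1)))
          (Real.exp_pos _).le (by have := hc.trans_le (hcCA t ht); positivity))
        (hT0 t ht) (hb t ht).2.2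
    · have hCb : CA t ≤ b := (le_abs_self _).trans (hb t ht).1
      refine div_le_div₀ (by positivity) ?_ ha (hb t ht).2.1
      calc k₀ * CA t * Real.exp (-(θ 4 / T t)) ≤ k₀ * CA t * 1 :=
            mul_le_mul_of_nonneg_left (hexp t ht)
              (by have := hc.trans_le (hcCA t ht); positivity)
        _ ≤ k₀ * b := by rw [mul_one]; exact mul_le_mul_of_nonneg_left hCb hk₀.le
    · -- `p` is a convex combination of `γ_b θ₃` and its initial value
      obtain ⟨e0, e1, _⟩ := hEb t ht
      have m1 := min_le_left (g.γb * θ 2) (g.γb * eta0 2)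
      have m2 := min_le_right (g.γb * θ 2) (g.γb * eta0 2)
      have e3 : p t = (1 - E t) * (g.γb * θ 2) + E t * (g.γb * eta0 2) := by rw [hp]; ring
      rw [e3]
      nlinarith [mul_le_mul_of_nonneg_left m1 (sub_nonneg.2 e1), mul_le_mul_of_nonneg_left m2 e0.le]
  have hsD : ExpDecay s :=
    ⟨D, κ, hκ, fun t ht => hED ht (hsB t ht) (by linarith [abs_nonneg (g.γb * (eta0 2 - θ 2))])⟩
  have hfin := hξ.add (hsD.of_le (h := fun t => -s t) 1 fun t _ => by simp)
  exact hfin.of_le 1 fun t _ => by simp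

end Run

/-! ### Existence of estimator runs -/

section Existence

open scoped Matrix Matrix.Norms.L2Operator

theorem abs_inv_max_one_sub_le (x y : ℝ) : |1 / max x 1 - 1 / max y 1| ≤ |x - y| := by
  have hx : 1 ≤ max x 1 := le_max_right _ _
  have hy : 1 ≤ max y 1 := le_max_right _ _
  have h : 1 / max x 1 - 1 / max y 1 = (max y 1 - max x 1) / (max x 1 * max y 1) := by
    field_simp
  rw [h, abs_div, abs_of_pos (by positivity : 0 < max x 1 * max y 1), abs_sub_comm x y]
  refine (div_le_self (abs_nonneg _) (by nlinarith)).trans ?_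
  exact abs_max_sub_max_le_abs y x 1

theorem abs_exp_neg_sub_le {x y : ℝ} (hx : 0 ≤ x) (hy : 0 ≤ y) :
    |Real.exp (-x) - Real.exp (-y)| ≤ |x - y| := by
  wlog h : x ≤ y generalizing x y
  · rw [abs_sub_comm, abs_sub_comm x y]
    exact this hy hx (not_le.1 h).le
  have h1 : Real.exp (-y) = Real.exp (-x) * Real.exp (-(y - x)) := by
    rw [← Real.exp_add]; congr 1; ring
  have h2 := Real.add_one_le_exp (-(y - x))
  have h3 : Real.exp (-x) ≤ 1 := Real.exp_le_one_iff.2 (by linarith)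
  have h4 : Real.exp (-(y - x)) ≤ 1 := Real.exp_le_one_iff.2 (by linarith)
  rw [h1, abs_of_nonneg (by nlinarith [Real.exp_pos (-x)]), abs_of_nonpos (by linarith)]
  nlinarith [Real.exp_pos (-x)]

/-- In the variables `y = z exp (β₀ t)` and `Q = (z F)⁻¹` the least-squares estimator has a
globally Lipschitz right-hand side, because `y` is nondecreasing and `Q ≥ f₀`. -/
theorem exists_information {g : Gains} (hg : g.Admissible) {φ : ℝ → Fin 5 → ℝ}
    (hφ : ContinuousOn φ (Ici 0)) :
    ∃ (y : ℝ → ℝ) (Q : ℝ → Matrix (Fin 5) (Fin 5) ℝ), y 0 = 1 ∧ Q 0 = g.f₀ • 1 ∧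
      (∀ t, 0 ≤ t → 1 ≤ y t) ∧
      (∀ t, 0 ≤ t → ∀ x, g.f₀ * (x ⬝ᵥ x) ≤ x ⬝ᵥ (Q t *ᵥ x)) ∧
      SolvesODE y (fun t => g.β₀ / g.M * Real.exp (g.β₀ * t) * ‖(Q t)⁻¹‖) ∧
      SolvesODE Q fun t =>
        (g.α * Real.exp (g.β₀ * t) * (1 / y t)) • Matrix.vecMulVec (φ t) (φ t) := by
  have hf := hg.2.2.2.1
  have hM := LeastSquares.M_pos hg
  have hα := hg.2.1
  have hβ := hg.2.2.1
  obtain ⟨h, K, hK, hb, heq⟩ := exists_lipschitz_norm_inverse (n := Fin 5) hf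
  set c : ℝ → ℝ := fun t => g.β₀ / g.M * Real.exp (g.β₀ * t) with hc
  set P : ℝ → Matrix (Fin 5) (Fin 5) ℝ := fun t =>
    (g.α * Real.exp (g.β₀ * t)) • Matrix.vecMulVec (φ t) (φ t) with hP
  have hcc : Continuous c := continuous_const.mul (continuous_exp_mul _)
  have hPc : ContinuousOn P (Ici 0) :=
    (continuous_const.mul (continuous_exp_mul _)).continuousOn.smul (continuousOn_vecMulVec hφ)
  have hc0 : ∀ t, 0 ≤ c t := fun t => by positivity
  have hbound : ∀ n : ℝ, 0 ≤ n → ∃ B : ℝ, 0 ≤ B ∧ ∀ t ∈ Icc 0 n, c t ≤ B ∧ ‖P t‖ ≤ B := by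
    intro n hn
    obtain ⟨B, hB⟩ := isCompact_Icc.bddAbove_image
      (((hcc.continuousOn (s := Ici 0)).add hPc.norm).mono (Icc_subset_Ici_self : Icc 0 n ⊆ Ici 0))
    have h1 : ∀ t ∈ Icc 0 n, c t + ‖P t‖ ≤ B := fun t ht => hB (mem_image_of_mem _ ht)
    exact ⟨B, (add_nonneg (hc0 0) (norm_nonneg _)).trans (h1 0 ⟨le_rfl, hn⟩), fun t ht =>
      ⟨by linarith [h1 t ht, norm_nonneg (P t)], by linarith [h1 t ht, hc0 t]⟩⟩
  set f : ℝ → ℝ × Matrix (Fin 5) (Fin 5) ℝ → ℝ × Matrix (Fin 5) (Fin 5) ℝ := fun t w =>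
    (c t * h w.2, (1 / max w.1 1) • P t) with hfdef
  have hcont : ∀ w, ContinuousOn (fun t => f t w) (Ici 0) := fun w => by
    have h2 : ContinuousOn (fun t => (1 / max w.1 1) • P t) (Ici 0) :=
      hPc.const_smul (1 / max w.1 1)
    exact (hcc.continuousOn.mul continuousOn_const).prodMk h2
  have hlip : ∀ n : ℝ, 0 ≤ n → ∃ K : NNReal, ∀ t ∈ Icc 0 n, LipschitzWith K (f t) := by
    intro n hn
    obtain ⟨B, hB0, hB⟩ := hbound n hn
    refine ⟨Real.toNNReal (B * K + B), fun t ht => LipschitzWith.of_dist_le_mul fun v w => ?_⟩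
    rw [Real.coe_toNNReal _ (by positivity), Prod.dist_eq]
    have h1 : dist v.1 w.1 ≤ dist v w := le_max_left _ _
    have h2 : dist v.2 w.2 ≤ dist v w := le_max_right _ _
    have hd : 0 ≤ dist v w := dist_nonneg
    refine max_le ?_ ?_
    · rw [Real.dist_eq, ← mul_sub, abs_mul, abs_of_nonneg (hc0 t), ← Real.dist_eq]
      calc c t * dist (h v.2) (h w.2) ≤ B * (K * dist v w) :=
            mul_le_mul (hB t ht).1 ((hK.dist_le_mul _ _).trans
              (mul_le_mul_of_nonneg_left h2 K.2)) dist_nonneg hB0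
        _ ≤ (B * K + B) * dist v w := by nlinarith [mul_nonneg hB0 hd]
    · rw [dist_eq_norm, ← sub_smul, norm_smul, Real.norm_eq_abs]
      calc _ ≤ dist v w * B := mul_le_mul ((abs_inv_max_one_sub_le _ _).trans
              ((Real.dist_eq _ _).symm.le.trans h1)) (hB t ht).2 (norm_nonneg _) hd
        _ ≤ (B * K + B) * dist v w := by
            have : 0 ≤ B * K * dist v w := mul_nonneg (mul_nonneg hB0 K.2) hd
            nlinarith
  have hbdd : ∀ n : ℝ, 0 ≤ n → ∃ L : NNReal, ∀ t ∈ Icc 0 n, ∀ w, ‖f t w‖ ≤ L := by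
    intro n hn
    obtain ⟨B, hB0, hB⟩ := hbound n hn
    refine ⟨Real.toNNReal (B * (1 / g.f₀) + B), fun t ht w => ?_⟩
    have hBf : 0 ≤ B * (1 / g.f₀) := by positivity
    rw [Real.coe_toNNReal _ (by positivity), Prod.norm_def]
    refine max_le ?_ ?_
    · rw [Real.norm_eq_abs, abs_of_nonneg (mul_nonneg (hc0 t) (hb _).1)]
      have := mul_le_mul (hB t ht).1 (hb w.2).2 (hb w.2).1 hB0
      linarith
    · have h1 : 1 / max w.1 1 ≤ 1 := (div_le_one (by positivity)).2 (le_max_right _ _)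
      rw [norm_smul, Real.norm_eq_abs, abs_of_nonneg (by positivity)]
      have := mul_le_mul h1 (hB t ht).2 (norm_nonneg _) zero_le_one
      linarith
  obtain ⟨x, hx0, hx⟩ := exists_solvesODE hcont hlip hbdd (1, g.f₀ • 1)
  have hy := hx.clm (ContinuousLinearMap.fst ℝ ℝ (Matrix (Fin 5) (Fin 5) ℝ))
  have hQ := hx.clm (ContinuousLinearMap.snd ℝ ℝ (Matrix (Fin 5) (Fin 5) ℝ))
  simp only [ContinuousLinearMap.coe_fst', ContinuousLinearMap.coe_snd'] at hy hQ
  have hy1 : ∀ t, 0 ≤ t → 1 ≤ (x t).1 := fun t ht =>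
    hy.ge_of_nonneg (by rw [hx0]) (fun s _ _ => mul_nonneg (hc0 s) (hb _).1) ht
  have hQ' : SolvesODE (fun t => (x t).2) fun t =>
      (g.α * Real.exp (g.β₀ * t) * (1 / (x t).1)) • Matrix.vecMulVec (φ t) (φ t) :=
    hQ.congr fun t ht => by
      simp only [hfdef, hP]; rw [max_eq_left (hy1 t ht), smul_smul, mul_comm]
  have hQ0 : (x 0).2 = g.f₀ • 1 := by rw [hx0]
  have hQc : ∀ t, 0 ≤ t → ∀ v, g.f₀ * (v ⬝ᵥ v) ≤ v ⬝ᵥ ((x t).2 *ᵥ v) := fun t ht =>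
    coercive_of_ode hQ0 hQ' (fun s hs => by have := hy1 s hs; positivity) ht
  exact ⟨fun t => (x t).1, fun t => (x t).2, congrArg Prod.fst hx0, hQ0, hy1, hQc,
    hy.congr fun t ht => by simp only [hfdef, hc]; rw [heq _ (hQc t ht)], hQ'⟩

theorem exists_leastSquares {g : Gains} (hg : g.Admissible) (μ : Fin 5 → ℝ) {φ : ℝ → Fin 5 → ℝ}
    (hφ : ContinuousOn φ (Ici 0)) :
    ∃ F z μh, LeastSquares g μ φ F z μh := by
  obtain ⟨y, Q, hy0, hQ0, hy1, hQc, hy, hQ⟩ := exists_information hg hφ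
  have hf := hg.2.2.2.1
  have hM := LeastSquares.M_pos hg
  have hinv := hQ.matrix_inv fun t ht => isUnit_of_coercive hf (hQc t ht)
  set z : ℝ → ℝ := fun t => Real.exp (-g.β₀ * t) * y t with hz
  have hzpos : ∀ t, 0 ≤ t → 0 < z t := fun t ht => by
    have := hy1 t ht
    positivity
  have hexp : ∀ t, Real.exp (-g.β₀ * t) * Real.exp (g.β₀ * t) = 1 := fun t => by
    rw [← Real.exp_add]; simp
  have hnorm : ∀ t, 0 ≤ t → z t * ‖(z t)⁻¹ • (Q t)⁻¹‖ = ‖(Q t)⁻¹‖ := fun t ht => by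
    rw [norm_smul, Real.norm_eq_abs, abs_of_pos (inv_pos.2 (hzpos t ht)),
      mul_inv_cancel_left₀ (hzpos t ht).ne']
  have hzode : SolvesODE z fun t => -(g.β₀ * (1 - ‖(z t)⁻¹ • (Q t)⁻¹‖ / g.M) * z t) := by
    refine ((solvesODE_exp_mul (-g.β₀)).mul hy).congr fun t ht => ?_
    have h1 := hnorm t ht
    have h2 := hexp t
    calc _ = -g.β₀ * z t + g.β₀ / g.M * ‖(Q t)⁻¹‖
            * (Real.exp (-g.β₀ * t) * Real.exp (g.β₀ * t)) := by rw [hz]; ring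
      _ = -g.β₀ * z t + g.β₀ / g.M * (z t * ‖(z t)⁻¹ • (Q t)⁻¹‖) := by rw [h1, h2, mul_one]
      _ = _ := by ring
  have ha : ∀ t, 0 ≤ t → g.α * Real.exp (g.β₀ * t) * (1 / y t) = g.α * (z t)⁻¹ := fun t ht => by
    have h2 := hexp t
    have hy' : y t ≠ 0 := (zero_lt_one.trans_le (hy1 t ht)).ne'
    have h3 : (z t)⁻¹ = Real.exp (g.β₀ * t) * (1 / y t) := by
      refine inv_eq_of_mul_eq_one_left ?_
      calc _ = Real.exp (-g.β₀ * t) * Real.exp (g.β₀ * t) * (y t * (1 / y t)) := by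
            simp only [hz]; ring
        _ = 1 := by rw [h2, mul_one_div_cancel hy', one_mul]
    rw [h3]; ring
  have hQi : (Q 0)⁻¹ = (1 / g.f₀) • 1 := by
    rw [hQ0]
    refine Matrix.inv_eq_right_inv ?_
    rw [smul_mul_smul_comm, mul_one_div_cancel hf.ne', one_smul, one_mul]
  have hz0 : z 0 = 1 := by simp [hz, hy0]
  refine ⟨fun t => (z t)⁻¹ • (Q t)⁻¹, z, fun t => μ + g.f₀ • ((Q t)⁻¹ *ᵥ (g.μ₀ - μ)), hφ, ?_, hz0,
    ?_, ?_, hzode, ?_⟩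
  · simp only [hz0, hQi, inv_one, one_smul]
  · simp only [hQi]
    rw [Matrix.smul_mulVec, Matrix.one_mulVec, smul_smul, mul_one_div_cancel hf.ne', one_smul]
    abel
  · refine ((hzode.inv fun t ht => (hzpos t ht).ne').smul hinv).congr fun t ht => ?_
    rw [ha t ht]
    have hzt := (hzpos t ht).ne'
    generalize g.β₀ * (1 - ‖(z t)⁻¹ • (Q t)⁻¹‖ / g.M) = b
    simp only [smul_neg, smul_mul_assoc, mul_smul_comm, smul_smul]
    congr 2
    · congr 1
      ring
    · field_simp
  · refine ((SolvesODE.const μ).add ((hinv.mulVec (SolvesODE.const (g.μ₀ - μ))).const_smul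
      g.f₀)).congr fun t ht => ?_
    rw [ha t ht]
    simp only [Matrix.neg_mulVec, Matrix.smul_mulVec, Matrix.mulVec_zero, add_zero, zero_add,
      smul_mul_assoc, mul_smul_comm, ← Matrix.mulVec_mulVec, Matrix.vecMulVec_mulVec,
      dotProduct_add, dotProduct_smul, op_smul_eq_smul, Matrix.mulVec_smul, smul_smul, smul_neg,
      smul_eq_mul]
    rw [← neg_smul]
    congr 1
    ring

theorem Fmat_mk (x : Fin 6 → ℝ) (μ : Fin 5 → ℝ) (F : Matrix (Fin 5) (Fin 5) ℝ) (η : Fin 4 → ℝ)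
    (z ρ : ℝ) : Fmat (Chi.mk x μ F η z ρ) = F := by
  ext i j
  rfl

theorem mixMat_mk (g : Gains) (x : Fin 6 → ℝ) (μ : Fin 5 → ℝ) (F : Matrix (Fin 5) (Fin 5) ℝ)
    (η : Fin 4 → ℝ) (z ρ : ℝ) : mixMat g (Chi.mk x μ F η z ρ) = 1 - (z * g.f₀) • F := by
  rw [mixMat, Fmat_mk]
  rfl

theorem Delta_mk (g : Gains) (x : Fin 6 → ℝ) (μ : Fin 5 → ℝ) (F : Matrix (Fin 5) (Fin 5) ℝ)
    (η : Fin 4 → ℝ) (z ρ : ℝ) : Delta g (Chi.mk x μ F η z ρ) = (1 - (z * g.f₀) • F).det := by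
  rw [Delta, mixMat_mk]

theorem Yvec_mk (g : Gains) (x : Fin 6 → ℝ) (μ : Fin 5 → ℝ) (F : Matrix (Fin 5) (Fin 5) ℝ)
    (η : Fin 4 → ℝ) (z ρ : ℝ) : Yvec g (Chi.mk x μ F η z ρ)
      = (1 - (z * g.f₀) • F).adjugate *ᵥ (μ - (z * g.f₀) • (F *ᵥ g.μ₀)) := by
  rw [Yvec, mixMat_mk, Fmat_mk]
  rfl

theorem LeastSquares.continuousOn_det {g : Gains} {μ : Fin 5 → ℝ} {φ : ℝ → Fin 5 → ℝ}
    {F : ℝ → Matrix (Fin 5) (Fin 5) ℝ} {z : ℝ → ℝ} {μh : ℝ → Fin 5 → ℝ}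
    (h : LeastSquares g μ φ F z μh) :
    ContinuousOn (fun t => (1 - (z t * g.f₀) • F t).det) (Ici 0) := by
  have hχ : ContinuousOn (fun t => Chi.mk 0 0 (F t) 0 (z t) 0) (Ici 0) := by
    refine continuousOn_pi.2 ?_
    rintro (i | i | ⟨i, j⟩ | i | i | i)
    · exact (continuousOn_const : ContinuousOn (fun _ : ℝ => (0 : ℝ)) _)
    · exact (continuousOn_const : ContinuousOn (fun _ : ℝ => (0 : ℝ)) _)
    · exact (h.F_ode.entry i j).1
    · exact (continuousOn_const : ContinuousOn (fun _ : ℝ => (0 : ℝ)) _)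
    · exact h.z_ode.1
    · exact (continuousOn_const : ContinuousOn (fun _ : ℝ => (0 : ℝ)) _)
  refine ((continuous_Delta g).comp_continuousOn hχ).congr fun t _ => ?_
  rw [Function.comp_apply, Delta_mk]

/-- A scalar equation whose right-hand side is nonnegative and globally Lipschitz on the
half-line `w ≥ 0`, which solutions from `0` never leave. -/
theorem exists_exponential_ode {D N : ℝ → ℝ} (hD : ContinuousOn D (Ici 0))
    (hN : ContinuousOn N (Ici 0)) (hD0 : ∀ t, 0 ≤ t → 0 ≤ D t) (hN0 : ∀ t, 0 ≤ t → 0 ≤ N t) :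
    ∃ w : ℝ → ℝ, w 0 = 0 ∧ SolvesODE w fun t => D t * Real.exp (-(N t * w t)) := by
  have hbound : ∀ n : ℝ, 0 ≤ n → ∃ B : ℝ, 0 ≤ B ∧ ∀ t ∈ Icc 0 n, D t ≤ B ∧ N t ≤ B := by
    intro n hn
    obtain ⟨B, hB⟩ := isCompact_Icc.bddAbove_image
      ((hD.add hN).mono (Icc_subset_Ici_self : Icc 0 n ⊆ Ici 0))
    have h1 : ∀ t ∈ Icc 0 n, D t + N t ≤ B := fun t ht => hB (mem_image_of_mem _ ht)
    exact ⟨B, (add_nonneg (hD0 0 le_rfl) (hN0 0 le_rfl)).trans (h1 0 ⟨le_rfl, hn⟩), fun t ht =>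
      ⟨by linarith [h1 t ht, hN0 t ht.1], by linarith [h1 t ht, hD0 t ht.1]⟩⟩
  set f : ℝ → ℝ → ℝ := fun t v => D t * Real.exp (-(N t * max v 0)) with hfdef
  have hcont : ∀ v, ContinuousOn (fun t => f t v) (Ici 0) := fun v =>
    hD.mul (Real.continuous_exp.comp_continuousOn (hN.mul continuousOn_const).neg)
  have hlip : ∀ n : ℝ, 0 ≤ n → ∃ K : NNReal, ∀ t ∈ Icc 0 n, LipschitzWith K (f t) := by
    intro n hn
    obtain ⟨B, hB0, hB⟩ := hbound n hn
    refine ⟨Real.toNNReal (B * B), fun t ht => LipschitzWith.of_dist_le_mul fun v w => ?_⟩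
    rw [Real.coe_toNNReal _ (by positivity), Real.dist_eq, Real.dist_eq, ← mul_sub, abs_mul,
      abs_of_nonneg (hD0 t ht.1), mul_assoc]
    refine mul_le_mul (hB t ht).1 ?_ (abs_nonneg _) hB0
    refine (abs_exp_neg_sub_le (mul_nonneg (hN0 t ht.1) (le_max_right _ _))
      (mul_nonneg (hN0 t ht.1) (le_max_right _ _))).trans ?_
    rw [← mul_sub, abs_mul, abs_of_nonneg (hN0 t ht.1)]
    exact mul_le_mul (hB t ht).2 (abs_max_sub_max_le_abs v w 0) (abs_nonneg _) hB0
  have hbdd : ∀ n : ℝ, 0 ≤ n → ∃ L : NNReal, ∀ t ∈ Icc 0 n, ∀ v, ‖f t v‖ ≤ L := by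
    intro n hn
    obtain ⟨B, hB0, hB⟩ := hbound n hn
    refine ⟨Real.toNNReal B, fun t ht v => ?_⟩
    rw [Real.coe_toNNReal _ hB0, Real.norm_eq_abs,
      abs_of_nonneg (mul_nonneg (hD0 t ht.1) (Real.exp_pos _).le)]
    refine (mul_le_of_le_one_right (hD0 t ht.1) ?_).trans (hB t ht).1
    rw [Real.exp_le_one_iff, neg_nonpos]
    exact mul_nonneg (hN0 t ht.1) (le_max_right _ _)
  obtain ⟨w, hw0, hw⟩ := exists_solvesODE hcont hlip hbdd 0
  have hpos : ∀ t, 0 ≤ t → 0 ≤ w t := fun t ht =>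
    hw.ge_of_nonneg hw0.ge (fun s hs _ => mul_nonneg (hD0 s hs) (Real.exp_pos _).le) ht
  exact ⟨w, hw0, hw.congr fun t ht => by simp only [hfdef]; rw [max_eq_left (hpos t ht)]⟩

theorem exists_filter (lam x₀ : ℝ) {v : ℝ → ℝ} (hv : Signal v) :
    ∃ x : ℝ → ℝ, x 0 = x₀ ∧ SolvesODE x fun t => lam * (v t - x t) :=
  ⟨fun t => x₀ * Real.exp (-lam * t) + lowpass lam v t, by simp [lowpass_zero],
    (((solvesODE_exp_mul (-lam)).const_mul x₀).add (lowpass_ode lam hv)).congr fun t _ => by ring⟩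

/-- The estimator is a cascade: the filters, the least-squares estimator, the scalar regressions
and the integral term can be solved one after the other. -/
theorem exists_run {k₀ : ℝ} {g : Gains} {θ : Fin 5 → ℝ} {CA T Tin u : ℝ → ℝ}
    (S : Scenario k₀ g θ CA T Tin u) (eta0 : Fin 4 → ℝ) (hη : 0 < g.γb * eta0 2) (rho0 : ℝ) :
    ∃ χ, IsEstimatorRun k₀ g CA T Tin u (initialState g eta0 rho0 (CA 0) (T 0)) χ := by
  have hCA := S.traj.1.1
  have hT := S.traj.2.1
  have hγa := S.gains.2.2.2.2.2.1
  have hsig : ∀ i, Signal fun t => filterInput CA T Tin u t i := fun i => by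
    have sC : Signal CA := Signal.of_continuousOn hCA
    fin_cases i
    · exact Signal.of_continuousOn continuousOn_const
    · exact S.signal_T_sub
    · exact sC
    · exact Signal.of_continuousOn S.input_cont
    · exact sC
    · exact Signal.of_continuousOn hT
  choose X hX0 hX using fun i =>
    exists_filter g.lam ((![0, 0, CA 0, 0, 0, T 0] : Fin 6 → ℝ) i) (hsig i)
  set φ : ℝ → Fin 5 → ℝ := fun t =>
    ![X 0 t, X 1 t, -(g.lam * (CA t - X 2 t)), -X 3 t, -X 4 t] with hφ
  have hφc : ContinuousOn φ (Ici 0) := by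
    refine continuousOn_pi.2 fun i => ?_
    fin_cases i
    · exact (hX 0).1
    · exact (hX 1).1
    · exact (continuousOn_const.mul (hCA.sub (hX 2).1)).neg
    · exact (hX 3).1.neg
    · exact (hX 4).1.neg
  obtain ⟨F, z, μh, hLS⟩ := exists_leastSquares S.gains (regressionParam θ) hφc
  have hz := hLS.z_ode.1
  have hΔ := hLS.continuousOn_det
  set k : ℝ → ℝ := fun t => g.γa * (1 - (z t * g.f₀) • F t).det ^ 2 with hk
  have hkc : ContinuousOn k (Ici 0) := continuousOn_const.mul (hΔ.pow 2)
  have hI := SolvesODE.integral_of_continuousOn hkc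
  set E : ℝ → ℝ := fun t => Real.exp (-∫ s in (0 : ℝ)..t, k s) with hEdef
  have hE : SolvesODE E fun t => -(k t * E t) := hI.neg.exp.congr fun t _ => by ring
  have hE1 : ∀ t, 0 ≤ t → E t ≤ 1 := fun t ht => by
    refine Real.exp_le_one_iff.2 (neg_nonpos.2 ?_)
    exact hI.ge_of_nonneg (by simp) (fun s _ _ => mul_nonneg hγa.le (sq_nonneg _)) ht
  set η : Fin 4 → ℝ → ℝ := fun i t => regressionParam θ i.castSucc
    + E t * (eta0 i - regressionParam θ i.castSucc) with hηdef
  have hηode : ∀ i, SolvesODE (η i) fun t =>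
      -(k t * E t) * (eta0 i - regressionParam θ i.castSucc) := fun i =>
    ((SolvesODE.const (regressionParam θ i.castSucc)).add
      (hE.mul (SolvesODE.const (eta0 i - regressionParam θ i.castSucc)))).congr fun t _ => by ring
  have hT0 : ∀ t, 0 ≤ t → 0 < T t := fun t ht => S.T_pos ht
  have hTne : ∀ t ∈ Ici (0 : ℝ), T t ≠ 0 := fun t ht => (hT0 t ht).ne'
  have hlogc : ContinuousOn (fun t => Real.log (T t)) (Ici 0) := hT.log hTne
  have hη2 : ∀ t, 0 ≤ t → 0 ≤ g.γb * η 2 t := fun t ht => by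
    have e1 : g.γb * η 2 t = (1 - E t) * (g.γb * θ 2) + E t * (g.γb * eta0 2) := by
      change g.γb * (θ 2 + E t * (eta0 2 - θ 2)) = _
      ring
    rw [e1]
    exact add_nonneg (mul_nonneg (sub_nonneg.2 (hE1 t ht)) S.θ2_sign.le)
      (mul_nonneg (Real.exp_pos _).le hη.le)
  -- the part of `ρ̇` that contains the measured signals is integrated separately
  set A : ℝ → ℝ := fun t => -(g.γb / T t) * (η 1 t * (Tin t - T t) + η 3 t * u t) with hA
  have hAs : Signal A := Signal.mul (continuousOn_const.div hT hTne).neg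
    ((Signal.mul (hηode 1).1 ((Signal.of_admissible S.influent).sub
      (Signal.of_continuousOn hT))).add
      (Signal.mul (hηode 3).1 (Signal.of_continuousOn S.input_cont)))
  set I : ℝ → ℝ := fun t => ∫ s in (0 : ℝ)..t, A s with hIdef
  have hIode : SolvesODE I A := hAs.ode
  obtain ⟨c, hc, hcCA⟩ := S.CA_lower
  obtain ⟨w, hw0, hw⟩ := exists_exponential_ode
    (D := fun t => g.γb * η 2 t * k₀ * CA t / T t
      * Real.exp (-((g.γb * Real.log (T t) + I t + rho0) / T t)))
    (N := fun t => 1 / T t)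
    (((((continuousOn_const.mul (hηode 2).1).mul continuousOn_const).mul hCA).div hT hTne).mul
      (Real.continuous_exp.comp_continuousOn
        ((((continuousOn_const.mul hlogc).add hIode.1).add continuousOn_const).div hT hTne).neg))
    (continuousOn_const.div hT hTne)
    (fun t ht => by
      have h1 := hη2 t ht
      have h2 := hT0 t ht
      have h3 := hc.trans_le (hcCA t ht)
      have h4 := S.k₀_pos
      positivity)
    (fun t ht => (one_div_pos.2 (hT0 t ht)).le)
  have hρ := ((SolvesODE.const rho0).add hIode).add hw
  set χ : ℝ → Chi := fun t => Chi.mk (fun i => X i t) (μh t) (F t) (fun i => η i t) (z t)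
    (rho0 + I t + w t) with hχ
  have hF : ∀ t, Fmat (χ t) = F t := fun t => Fmat_mk _ _ _ _ _ _
  refine ⟨χ, ?_, SolvesODE.pi ?_⟩
  · have hE0 : E 0 = 1 := by simp [hEdef]
    have hη0 : (fun i => η i 0) = eta0 := by
      ext i
      simp [hηdef, hE0]
    have hρ0 : rho0 + I 0 + w 0 = rho0 := by simp [hIdef, hw0]
    have hX0' : (fun i => X i 0) = ![0, 0, CA 0, 0, 0, T 0] := funext hX0
    simp only [hχ, hη0, hρ0, hX0', hLS.mu_init, hLS.F_init, hLS.z_init]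
    rfl
  · rintro (i | i | ⟨i, j⟩ | i | i | i)
    · exact hX i
    · refine (hLS.mu_ode.apply i).congr fun t ht => ?_
      change _ = ((g.α * (-(g.lam * (T t - X 5 t)) - φ t ⬝ᵥ μh t)) • (Fmat (χ t) *ᵥ φ t)) i
      rw [hF, filtered_regression S hX0 hX ht]
    · refine (hLS.F_ode.entry i j).congr fun t _ => ?_
      change _ = (-(g.α • (Fmat (χ t) * Matrix.vecMulVec (φ t) (φ t) * Fmat (χ t)))
        + (g.β₀ * (1 - ‖Fmat (χ t)‖ / g.M)) • Fmat (χ t)) i j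
      rw [hF]
    · refine (hηode i).congr fun t ht => ?_
      have h := congrFun (hLS.mixing S.gains ht) i.castSucc
      change _ = g.γa * Delta g (χ t) * (Yvec g (χ t) i.castSucc - Delta g (χ t) * η i t)
      simp only [hχ, Delta_mk, Yvec_mk]
      rw [h]
      simp only [hk, hηdef, Pi.smul_apply, smul_eq_mul]
      ring
    · refine hLS.z_ode.congr fun t _ => ?_
      change _ = -(g.β₀ * (1 - ‖Fmat (χ t)‖ / g.M) * z t)
      rw [hF]
    · refine hρ.congr fun t ht => ?_
      change 0 + A t + _ = g.γb * (η 1 t * (Tin t - T t) + η 3 t * u t - η 2 t * k₀ * CA t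
        * Real.exp (-((g.γb * Real.log (T t) + (rho0 + I t + w t)) / T t))) * (-(1 / T t))
      have e : Real.exp (-((g.γb * Real.log (T t) + (rho0 + I t + w t)) / T t))
          = Real.exp (-((g.γb * Real.log (T t) + I t + rho0) / T t))
            * Real.exp (-(1 / T t * w t)) := by
        rw [← Real.exp_add]
        congr 1
        ring
      rw [e, hA]
      ring

end Existence

/-! ### Boundedness and conclusion -/

theorem exists_uniform_bound {ι : Type*} [Fintype ι] {f : ι → ℝ → ℝ}
    (h : ∀ i, ∃ b, ∀ t, 0 ≤ t → |f i t| ≤ b) : ∃ b, ∀ t, 0 ≤ t → ∀ i, |f i t| ≤ b := by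
  choose b hb using h
  have hb0 : ∀ i, 0 ≤ b i := fun i => (abs_nonneg _).trans (hb i 0 le_rfl)
  exact ⟨∑ i, b i, fun t ht i => (hb i t ht).trans
    (Finset.single_le_sum (fun j _ => hb0 j) (Finset.mem_univ i))⟩

section

open scoped Matrix Matrix.Norms.L2Operator

theorem LeastSquares.muHat_bdd {g : Gains} {μ : Fin 5 → ℝ} {φ : ℝ → Fin 5 → ℝ}
    {F : ℝ → Matrix (Fin 5) (Fin 5) ℝ} {z : ℝ → ℝ} {μh : ℝ → Fin 5 → ℝ}
    (h : LeastSquares g μ φ F z μh) (hg : g.Admissible) (i : Fin 5) :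
    ∃ b, ∀ t, 0 ≤ t → |μh t i| ≤ b := by
  have hf := hg.2.2.2.1
  refine ⟨|μ i| + g.f₀ * ∑ j, 1 / g.f₀ * |(g.μ₀ - μ) j|, fun t ht => ?_⟩
  have hG : ‖z t • F t‖ ≤ 1 / g.f₀ :=
    opNorm_inverse_le hf (h.info_coercive hg ht) (h.mul_info hg ht)
  rw [h.muHat_eq hg ht, Pi.add_apply, Pi.smul_apply, smul_eq_mul]
  refine (abs_add_le _ _).trans (add_le_add le_rfl ?_)
  rw [abs_mul, abs_of_pos hf]
  simp only [Matrix.mulVec, dotProduct]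
  refine mul_le_mul_of_nonneg_left ((Finset.abs_sum_le_sum_abs _ _).trans
    (Finset.sum_le_sum fun j _ => ?_)) hf.le
  rw [abs_mul]
  exact mul_le_mul_of_nonneg_right ((abs_entry_le_opNorm _ i j).trans hG) (abs_nonneg _)

theorem LeastSquares.F_bdd {g : Gains} {μ : Fin 5 → ℝ} {φ : ℝ → Fin 5 → ℝ}
    {F : ℝ → Matrix (Fin 5) (Fin 5) ℝ} {z : ℝ → ℝ} {μh : ℝ → Fin 5 → ℝ}
    (h : LeastSquares g μ φ F z μh) (hg : g.Admissible) (i j : Fin 5) :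
    ∃ b, ∀ t, 0 ≤ t → |F t i j| ≤ b :=
  ⟨g.M, fun _ ht => (abs_entry_le_opNorm _ i j).trans (h.norm_F_le hg ht)⟩

end

theorem Run.conclusion {k₀ : ℝ} {g : Gains} {θ : Fin 5 → ℝ} {CA T Tin u : ℝ → ℝ}
    {eta0 : Fin 4 → ℝ} {rho0 : ℝ} {χ : ℝ → Chi} (S : Scenario k₀ g θ CA T Tin u)
    (hIE : IntervalExciting (regressor g.lam CA T Tin u)) (hη : 0 < g.γb * eta0 2)
    (R : IsEstimatorRun k₀ g CA T Tin u (initialState g eta0 rho0 (CA 0) (T 0)) χ) :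
    (∀ t, 0 ≤ t → etaHat (χ t) 2 ≠ 0) ∧
    (∀ i, ExpDecay fun t => outputMap g (χ t) (CA t) (T t) (Tin t) (u t) i - θ i) ∧
    ∃ b, ∀ t, 0 ≤ t → ∀ i, |χ t i| ≤ b := by
  obtain ⟨E, k, C, κ, hκ, hE, hk, hEb, hηE⟩ := exists_error_factor S hIE R
  have hED : ExpDecay E :=
    ⟨C, κ, hκ, fun t ht => by rw [abs_of_pos (hEb t ht).1]; exact (hEb t ht).2.2⟩
  have h0 : ∀ t, 0 ≤ t → etaHat (χ t) 0 = θ 0 * θ 2 + E t * (eta0 0 - θ 0 * θ 2) :=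
    fun t ht => hηE t ht 0
  have h2 : ∀ t, 0 ≤ t → etaHat (χ t) 2 = θ 2 + E t * (eta0 2 - θ 2) := fun t ht => hηE t ht 2
  set m := min (g.γb * θ 2) (g.γb * eta0 2) with hm
  have hm0 : 0 < m := lt_min S.θ2_sign hη
  -- `η̂₃` is a convex combination of `θ₃` and its initial value, which have the same sign
  have hlow : ∀ t, 0 ≤ t → m ≤ g.γb * etaHat (χ t) 2 := fun t ht => by
    obtain ⟨e0, e1, _⟩ := hEb t ht
    rw [h2 t ht]
    nlinarith [mul_le_mul_of_nonneg_left (min_le_left (g.γb * θ 2) (g.γb * eta0 2))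
      (sub_nonneg.2 e1), mul_le_mul_of_nonneg_left (min_le_right (g.γb * θ 2) (g.γb * eta0 2))
      e0.le]
  have hne : ∀ t, 0 ≤ t → etaHat (χ t) 2 ≠ 0 := fun t ht h => by
    have := hlow t ht
    rw [h, mul_zero] at this
    linarith
  have h5 := expDecay_theta5 S hη R hκ hE hk hEb hηE
  have hdir : ∀ i : Fin 4, ExpDecay fun t => etaHat (χ t) i - regressionParam θ i.castSucc :=
    fun i => hED.of_le |eta0 i - regressionParam θ i.castSucc| fun t ht => by
      rw [hηE t ht i, add_sub_cancel_left, abs_mul, mul_comm]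
  have hout : ∀ i, ExpDecay fun t => outputMap g (χ t) (CA t) (T t) (Tin t) (u t) i - θ i := by
    intro i
    fin_cases i
    · refine hED.of_le (|eta0 0 - θ 0 * eta0 2| * |g.γb| / m) fun t ht => ?_
      change |etaHat (χ t) 0 / etaHat (χ t) 2 - θ 0| ≤ _
      have e1 : etaHat (χ t) 0 / etaHat (χ t) 2 - θ 0
          = E t * (eta0 0 - θ 0 * eta0 2) / etaHat (χ t) 2 := by
        rw [div_sub' (hne t ht)]
        congr 1
        rw [h0 t ht, h2 t ht]
        ring
      have e2 : m ≤ |g.γb| * |etaHat (χ t) 2| := by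
        rw [← abs_mul]
        exact (hlow t ht).trans (le_abs_self _)
      rw [e1, abs_div, abs_mul, div_le_iff₀ (abs_pos.2 (hne t ht))]
      calc |E t| * |eta0 0 - θ 0 * eta0 2|
          = |eta0 0 - θ 0 * eta0 2| * |E t| / m * m := by field_simp
        _ ≤ |eta0 0 - θ 0 * eta0 2| * |E t| / m * (|g.γb| * |etaHat (χ t) 2|) :=
          mul_le_mul_of_nonneg_left e2 (by positivity)
        _ = _ := by ring
    · exact hdir 1
    · exact hdir 2
    · exact hdir 3
    · exact h5
  refine ⟨hne, hout, exists_uniform_bound (f := fun i t => χ t i) ?_⟩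
  have hLS := leastSquares S R
  obtain ⟨bf, hbf⟩ := filt_bdd S R
  rintro (i | i | ⟨i, j⟩ | i | i | i)
  · exact ⟨bf, fun t ht => hbf t ht i⟩
  · exact hLS.muHat_bdd S.gains i
  · exact hLS.F_bdd S.gains i j
  · obtain ⟨b, hb⟩ := (hdir i).bdd
    refine ⟨b + |regressionParam θ i.castSucc|, fun t ht => ?_⟩
    have := (abs_add_le _ _).trans (add_le_add (hb t ht) (le_refl |regressionParam θ i.castSucc|))
    rwa [sub_add_cancel] at this
  · rw [Fin.fin_one_eq_zero i]
    refine ⟨1, fun t ht => ?_⟩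
    have h1 := hLS.z_pos ht
    exact abs_le.2 ⟨by change -1 ≤ zState (χ t); linarith, hLS.z_le_one S.gains ht⟩
  · rw [Fin.fin_one_eq_zero i]
    obtain ⟨a, b, ha, hb⟩ := S.bdd
    obtain ⟨c, hc⟩ := h5.bdd
    refine ⟨c + |g.γb| * (|Real.log a| + |Real.log b|) + |θ 4|, fun t ht => ?_⟩
    change |rhoI (χ t)| ≤ _
    have l1 := Real.log_le_log ha (hb t ht).2.1
    have l2 := Real.log_le_log (S.T_pos ht) (hb t ht).2.2
    have l3 : |Real.log (T t)| ≤ |Real.log a| + |Real.log b| :=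
      abs_le.2 ⟨by linarith [neg_abs_le (Real.log a), abs_nonneg (Real.log b)],
        by linarith [le_abs_self (Real.log b), abs_nonneg (Real.log a)]⟩
    have e : rhoI (χ t) = g.γb * Real.log (T t) + rhoI (χ t) - θ 4 - g.γb * Real.log (T t) + θ 4 := by
      ring
    rw [e]
    refine (abs_add_le _ _).trans (add_le_add ((abs_sub _ _).trans
      (add_le_add (hc t ht) ?_)) le_rfl)
    rw [abs_mul]
    exact mul_le_mul_of_nonneg_left l3 (abs_nonneg _)

end

end CSTR

theorem proposition1
    (k₀ : ℝ) (hk₀ : 0 < k₀)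
    (g : CSTR.Gains) (hg : g.Admissible)
    (θ : Fin 5 → ℝ)
    (hθ1 : 0 < θ 0) (hθ2 : 0 < θ 1) (hθ3 : 0 < g.γb * θ 2) (hθ4 : 0 < θ 3) (hθ5 : 0 < θ 4)
    (CA T Tin u : ℝ → ℝ)
    (hTin : CSTR.AdmissibleInfluent Tin)
    (hu : ContinuousOn u (Set.Ici 0))
    (hCA0 : 0 < CA 0) (hT0 : 0 < T 0)
    (htraj : CSTR.IsReactorTrajectory k₀ θ CA T Tin u)
    (hbdd : CSTR.BoundedTrajectory CA T)
    (hIE : CSTR.IntervalExciting (CSTR.regressor g.lam CA T Tin u))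
    (eta0 : Fin 4 → ℝ) (hη : 0 < g.γb * eta0 2) (rho0 : ℝ) :
    (∃ χ : ℝ → CSTR.Chi,
      CSTR.IsEstimatorRun k₀ g CA T Tin u (CSTR.initialState g eta0 rho0 (CA 0) (T 0)) χ) ∧
    ∀ χ : ℝ → CSTR.Chi,
      CSTR.IsEstimatorRun k₀ g CA T Tin u (CSTR.initialState g eta0 rho0 (CA 0) (T 0)) χ →
      -- the division in the output map is never by zero
      (∀ t : ℝ, 0 ≤ t → CSTR.etaHat (χ t) 2 ≠ 0) ∧
      -- the error decays exponentially
      (∃ c κ : ℝ, 0 < κ ∧ ∀ t : ℝ, 0 ≤ t →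
        Real.sqrt (∑ i : Fin 5,
          (CSTR.outputMap g (χ t) (CA t) (T t) (Tin t) (u t) i - θ i) ^ 2)
            ≤ c * Real.exp (-(κ * t))) ∧
      -- all signals are bounded
      (∃ b : ℝ, ∀ t : ℝ, 0 ≤ t → (∀ i : CSTR.ChiIdx, |χ t i| ≤ b) ∧
        ∀ i : Fin 5, |CSTR.outputMap g (χ t) (CA t) (T t) (Tin t) (u t) i| ≤ b) := by
  have S : CSTR.Scenario k₀ g θ CA T Tin u :=
    ⟨hk₀, hg, hθ1, hθ2, hθ3, hθ4, hθ5, hTin, hu, hCA0, htraj, hbdd⟩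
  refine ⟨CSTR.exists_run S eta0 hη rho0, fun χ R => ?_⟩
  obtain ⟨hne, hout, b, hb⟩ := CSTR.Run.conclusion S hIE hη R
  refine ⟨hne, ?_, ?_⟩
  · obtain ⟨c, κ, hκ, hc⟩ := CSTR.ExpDecay.sum Finset.univ fun i _ => (hout i).abs
    refine ⟨c, κ, hκ, fun t ht => le_trans ?_ ((le_abs_self _).trans (hc t ht))⟩
    refine Real.sqrt_le_iff.2 ⟨Finset.sum_nonneg fun i _ => abs_nonneg _, ?_⟩
    simp only [← sq_abs (_ - θ _)]
    exact Finset.sum_sq_le_sq_sum_of_nonneg fun i _ => abs_nonneg _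
  · obtain ⟨d, hd⟩ := CSTR.exists_uniform_bound fun i => (hout i).bdd
    obtain ⟨e, he⟩ := CSTR.exists_uniform_bound (f := fun i _ => θ i) fun i =>
      ⟨|θ i|, fun _ _ => le_rfl⟩
    refine ⟨max b (d + e), fun t ht => ⟨fun i => (hb t ht i).trans (le_max_left _ _), fun i => ?_⟩⟩
    have h := (abs_add_le _ _).trans (add_le_add (hd t ht i) (he t ht i))
    rw [sub_add_cancel] at h
    exact h.trans (le_max_right _ _)
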